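/- For $k\in\mathbb N$ let $R_k\subset\mathbb C$ be the set of numbers $a+b\sqrt2+ci+di\sqrt2$ in which each of $a,b,c,d$ is a fraction $p/q$ with $p,q\in\{-2^k,\dots,2^k\}$ integers, $q\neq0$. A Pauli-LIMDD on $n$ qubits is a finite rooted directed acyclic graph with one leaf (of index $0$) and a root of index $n$. Every node $v$ of index $m+1$ has a low and a high edge to nodes of index $m$. An edge to a node of index $m$ (including a root edge, which points to the root) carries a label that is $0$ or $\lambda P_m\otimes\dots\otimes P_1$ with $\lambda\in\mathbb C\setminus\{0\}$ and Pauli matrices $P_j$. An edge $e$ with label $A$ to a node $v$ represents $|e\rangle=A|v\rangle$, where $|v\rangle=1$ for the leaf and $|v\rangle=|0\rangle\otimes|\mathrm{low}_v\rangle+|1\rangle\otimes|\mathrm{high}_v\rangle$ otherwise. Assume the usual normalization rules, which every reduced LIMDD obeys: every low edge is labelled by the identity (or it is labelled $0$ and the high edge of that node is labelled by the identity), and if an edge of a node is labelled $0$, then both edges of that node have the same target. For an edge $e$ with label $\lambda P_m\otimes\dots\otimes P_1$ to a node $v$ of index $m\ge1$ and a bit $j$, $\textsc{Follow}_j(e)$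 computes $\gamma$ and $y$ with $\langle j|\lambda P_m=\gamma\langle y|$, and returns the low ($y=0$) or high ($y=1$) edge of $v$ with its label multiplied by $\gamma P_{m-1}\otimes\dots\otimes P_1$. For an edge $e$ with scalar $\lambda$ to a node $v$, $\textsc{SquaredNorm}(e)$ returns $|\lambda|^2$ if $v$ is the leaf. Otherwise, with $e_v$ the edge to $v$ labelled by the identity, it returns $|\lambda|^2\cdot s_v$, where $s_v=\textsc{SquaredNorm}(\textsc{Follow}_0(e_v))+\textsc{SquaredNorm}(\textsc{Follow}_1(e_v))$ is computed once for each node $v$ and kept in a cache. $\textsc{MeasurementProbability}(e)$ computes $s_j=\textsc{SquaredNorm}(\textsc{Follow}_j(e))$ for $j=0,1$ and returns $s_0/(s_0+s_1)$. **Statement.** There is a constant $C\in\mathbb N$ such that the following holds for all $n\ge1$ and $t\ge0$. Let $|\varphi\rangle$ be the output, on input $|0\rangle^{\otimes n}$, of a circuit of $H$, $S$, $\mathrm{CNOT}$ and $T$ gates with exactly $t$ $T$ gates, and let a normalized Pauli-LIMDD on $n$ qubits with root edge $e$ satisfy $|e\rangle=|\varphi\rangle$. Then every number encountered (read as the scalar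 of an edge label or from the cache, or computed) while running $\textsc{MeasurementProbability}(e)$ or $\textsc{SquaredNorm}(e)$ from an empty cache lies in $R_{C(n+t)}$. -/

import Mathlib

/-! ## Numbers -/

/-- Fractions `p / q` whose numerator and denominator are integers in `{-2^k, …, 2^k}`. -/
def boundedFractions (k : ℕ) : Set ℚ :=
  {r | ∃ p q : ℤ, |p| ≤ 2 ^ k ∧ |q| ≤ 2 ^ k ∧ q ≠ 0 ∧ r = (p : ℚ) / (q : ℚ)}

/-- `R_k`: the numbers `a + b√2 + c i + d i√2` whose four coefficients are fractions with
numerator and denominator in `{-2^k, …, 2^k}`. -/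
def RNumbers (k : ℕ) : Set ℂ :=
  {z | ∃ a ∈ boundedFractions k, ∃ b ∈ boundedFractions k,
       ∃ c ∈ boundedFractions k, ∃ d ∈ boundedFractions k,
       z = (a : ℂ) + (b : ℂ) * (√2 : ℝ) + (c : ℂ) * Complex.I
         + (d : ℂ) * Complex.I * (√2 : ℝ)}

/-! ## Clifford+T circuits -/

/-- Vectors of `n` qubits in the computational basis; coordinate `0` of a bit string is the
top qubit. -/
abbrev QVec (n : ℕ) : Type := (Fin n → Fin 2) → ℂ

/-- The gates `H`, `S`, `CNOT` (which generate the Clifford group) and `T`. -/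
inductive Gate (n : ℕ) : Type
  | H (i : Fin n)
  | S (i : Fin n)
  | T (i : Fin n)
  | CNOT (control target : Fin n) (hne : control ≠ target)

/-- The one-qubit operator `U` acting on qubit `i`. -/
def applyOneQubit {n : ℕ} (U : Matrix (Fin 2) (Fin 2) ℂ) (i : Fin n) (ψ : QVec n) : QVec n :=
  fun x => ∑ b : Fin 2, U (x i) b * ψ (Function.update x i b)

noncomputable section

def Gate.apply {n : ℕ} : Gate n → QVec n → QVec n
  | .H i, ψ => applyOneQubit ((1 / (√2 : ℝ) : ℂ) • !![1, 1; 1, -1]) i ψ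
  | .S i, ψ => applyOneQubit !![1, 0; 0, Complex.I] i ψ
  | .T i, ψ => applyOneQubit !![1, 0; 0, Complex.exp (Complex.I * (Real.pi : ℂ) / 4)] i ψ
  | .CNOT c t _, ψ => fun x => ψ (Function.update x t (x t + x c))

/-- `1` for a `T` gate and `0` for a Clifford gate. -/
def Gate.tWeight {n : ℕ} : Gate n → ℕ
  | .T _ => 1
  | _ => 0

/-- The number of `T` gates of a circuit. -/
def tCount {n : ℕ} (circuit : List (Gate n)) : ℕ := (circuit.map Gate.tWeight).sum

/-- The output of a circuit (a list of gates, first gate first) on input `|0…0⟩`. -/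
def circuitState {n : ℕ} (circuit : List (Gate n)) : QVec n :=
  circuit.foldl (fun ψ g => g.apply ψ) (Pi.single 0 1)

/-! ## Pauli strings and Pauli-LIMs -/

inductive Pauli : Type
  | I | X | Y | Z

def Pauli.mat : Pauli → Matrix (Fin 2) (Fin 2) ℂ
  | .I => !![1, 0; 0, 1]
  | .X => !![0, 1; 1, 0]
  | .Y => !![0, -Complex.I; Complex.I, 0]
  | .Z => !![1, 0; 0, -1]

/-- The product of two Pauli matrices up to its phase. -/
def Pauli.mulLetter : Pauli → Pauli → Pauli
  | .I, Q => Q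
  | P, .I => P
  | .X, .X => .I
  | .Y, .Y => .I
  | .Z, .Z => .I
  | .X, .Y => .Z
  | .Y, .X => .Z
  | .Y, .Z => .X
  | .Z, .Y => .X
  | .Z, .X => .Y
  | .X, .Z => .Y

/-- The phase of the product: `P.mat * Q.mat = mulPhase P Q • (mulLetter P Q).mat`. -/
def Pauli.mulPhase : Pauli → Pauli → ℂ
  | .X, .Y => Complex.I
  | .Y, .Z => Complex.I
  | .Z, .X => Complex.I
  | .Y, .X => -Complex.I
  | .Z, .Y => -Complex.I
  | .X, .Z => -Complex.I
  | _, _ => 1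

/-- The column of the only nonzero entry of row `j` of a Pauli matrix. -/
def Pauli.column : Pauli → Fin 2 → Fin 2
  | .I, j => j
  | .Z, j => j
  | .X, j => 1 - j
  | .Y, j => 1 - j

/-- An edge label: a Pauli-LIM `λ P_m ⊗ … ⊗ P_1`, or the label `0` (when `coeff = 0`).
Position `0` of the string is the top qubit. -/
structure PauliLIM (m : ℕ) : Type where
  coeff : ℂ
  string : Fin m → Pauli

namespace PauliLIM

/-- The label `𝟙^{⊗m}`. -/
def one (m : ℕ) : PauliLIM m := ⟨1, fun _ => .I⟩

/-- The `2^m × 2^m` matrix of a label. -/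
def toMatrix {m : ℕ} (A : PauliLIM m) : Matrix (Fin m → Fin 2) (Fin m → Fin 2) ℂ :=
  fun x y => A.coeff * ∏ i, (A.string i).mat (x i) (y i)

/-- The phase that arises when the Pauli strings of two labels are multiplied. -/
def phase {m : ℕ} (A B : PauliLIM m) : ℂ := ∏ i, Pauli.mulPhase (A.string i) (B.string i)

/-- The product of two labels. -/
def mul {m : ℕ} (A B : PauliLIM m) : PauliLIM m :=
  ⟨A.coeff * B.coeff * phase A B, fun i => Pauli.mulLetter (A.string i) (B.string i)⟩

end PauliLIM

/-! ## Pauli-LIMDDs -/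

/-- A Pauli-LIMDD on `n` qubits: a finite rooted directed acyclic graph. `Node m` is the set of
its nodes of index `m`; there is one leaf, of index `0`, and the root has index `n`. Every node of
index `m + 1` has a low and a high edge to nodes of index `m`, labelled by Pauli-LIMs or by `0`,
and there is a labelled root edge. -/
structure LIMDD (n : ℕ) : Type 1 where
  Node : ℕ → Type
  node_finite : ∀ m, Finite (Node m)
  index_le : ∀ m, n < m → IsEmpty (Node m)
  leaf : Node 0
  leaf_unique : ∀ v : Node 0, v = leaf
  low : ∀ {m : ℕ}, Node (m + 1) → Node m
  high : ∀ {m : ℕ}, Node (m + 1) → Node m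
  lowLabel : ∀ {m : ℕ}, Node (m + 1) → PauliLIM m
  highLabel : ∀ {m : ℕ}, Node (m + 1) → PauliLIM m
  root : Node n
  rootLabel : PauliLIM n

namespace LIMDD

variable {n : ℕ} (D : LIMDD n)

/-- A labelled edge to a node of index `m`. -/
structure Edge (m : ℕ) : Type where
  label : PauliLIM m
  target : D.Node m

def rootEdge : D.Edge n := ⟨D.rootLabel, D.root⟩

def lowEdge {m : ℕ} (v : D.Node (m + 1)) : D.Edge m := ⟨D.lowLabel v, D.low v⟩

def highEdge {m : ℕ} (v : D.Node (m + 1)) : D.Edge m := ⟨D.highLabel v, D.high v⟩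

/-- The vector `|v⟩`: it is `1` for the leaf, and otherwise
`|0⟩ ⊗ A|low v⟩ + |1⟩ ⊗ B|high v⟩` with `A`, `B` the labels of the low and the high edge. -/
def nodeVec : {m : ℕ} → D.Node m → QVec m
  | 0, _ => fun _ => 1
  | _ + 1, v => fun x =>
      if x 0 = 0 then ((D.lowLabel v).toMatrix.mulVec (nodeVec (D.low v))) (Fin.tail x)
      else ((D.highLabel v).toMatrix.mulVec (nodeVec (D.high v))) (Fin.tail x)

/-- The vector `|e⟩ = A|v⟩` of an edge with label `A` and target `v`. -/
def edgeVec {m : ℕ} (e : D.Edge m) : QVec m := e.label.toMatrix.mulVec (D.nodeVec e.target)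

/-- The normalization rules on edge labels. Low factoring: the low edge of every node is labelled
by the identity; more liberally, a low edge may be labelled `0` if the high edge is labelled by the
identity. Zero edges: if an edge of a node has label `0`, then both edges of the node have the same
target. Every reduced (and every semi-reduced) Pauli-LIMDD obeys these rules. -/
structure IsNormalized : Prop where
  factoring : ∀ {m : ℕ} (v : D.Node (m + 1)), D.lowLabel v = PauliLIM.one m ∨
    ((D.lowLabel v).coeff = 0 ∧ D.highLabel v = PauliLIM.one m)
  zero_edge : ∀ {m : ℕ} (v : D.Node (m + 1)),
    ((D.lowLabel v).coeff = 0 ∨ (D.highLabel v).coeff = 0) → D.low v = D.high v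

/-! ## The measurement algorithms -/

/-- The memory of a run: the cache of `SquaredNorm`, and a log of all numbers that have been read
or computed so far. -/
structure Memory : Type where
  cache : (m : ℕ) → D.Node m → Option ℂ
  log : List ℂ

/-- The initial memory: nothing cached, nothing logged. -/
def initialMemory : D.Memory := ⟨fun _ _ => none, []⟩

/-- An algorithm that returns an element of `α`. -/
abbrev Algorithm (α : Type) : Type := StateM D.Memory α

/-- Read or compute the number `z`: enter it into the log and return it. -/
def compute (z : ℂ) : D.Algorithm ℂ :=
  modifyGet fun s => (z, { s with log := z :: s.log })

/-- Look `v` up in the cache. -/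
def lookup {m : ℕ} (v : D.Node m) : D.Algorithm (Option ℂ) :=
  do return (← get).cache m v

open Classical in
/-- Store `z` in the cache as the value of `v`. -/
def store {m : ℕ} (v : D.Node m) (z : ℂ) : D.Algorithm Unit :=
  modify fun s =>
    { s with cache := fun m' w => if (⟨m', w⟩ : Σ k, D.Node k) = ⟨m, v⟩ then some z
                                  else s.cache m' w }

/-- `Follow` for one bit `j`. For an edge with label `λ P_m ⊗ … ⊗ P_1`, write
`⟨j| λ P_m = γ ⟨y|`, take the low (`y = 0`) or high (`y = 1`) edge of the target, and multiply its
label by `γ P_{m-1} ⊗ … ⊗ P_1`. -/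
def follow {m : ℕ} (j : Fin 2) (e : D.Edge (m + 1)) : D.Algorithm (D.Edge m) := do
  let coeff ← D.compute e.label.coeff
  let P := e.label.string 0
  let y := P.column j
  let γ ← D.compute (coeff * P.mat j y)
  let child := if y = 0 then D.lowEdge e.target else D.highEdge e.target
  let rest : PauliLIM m := ⟨γ, Fin.tail e.label.string⟩
  let α ← D.compute child.label.coeff
  let _ ← D.compute (γ * α)
  let _ ← D.compute (PauliLIM.phase rest child.label)
  let _ ← D.compute (PauliLIM.mul rest child.label).coeff
  return ⟨PauliLIM.mul rest child.label, child.target⟩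

/-- `SquaredNorm`, by recursion on the index of the target node. -/
def squaredNorm : {m : ℕ} → D.Edge m → D.Algorithm ℂ
  | 0, e => do
      let coeff ← D.compute e.label.coeff
      D.compute (Complex.normSq coeff : ℝ)
  | m + 1, e => do
      let value ← (do
        match ← D.lookup e.target with
        | some s => D.compute s
        | none =>
            let s₀ ← squaredNorm (← D.follow 0 ⟨PauliLIM.one (m + 1), e.target⟩)
            let s₁ ← squaredNorm (← D.follow 1 ⟨PauliLIM.one (m + 1), e.target⟩)
            let s ← D.compute (s₀ + s₁)
            D.store e.target s
            return s)
      let coeff ← D.compute e.label.coeff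
      let sq ← D.compute (Complex.normSq coeff : ℝ)
      D.compute (sq * value)

/-- `MeasurementProbability`: the probability of outcome `0` for the top qubit. -/
def measurementProbability {m : ℕ} (e : D.Edge (m + 1)) : D.Algorithm ℂ := do
  let s₀ ← D.squaredNorm (← D.follow 0 e)
  let s₁ ← D.squaredNorm (← D.follow 1 e)
  let s ← D.compute (s₀ + s₁)
  D.compute (s₀ / s)

/-- The numbers encountered when an algorithm is run from the initial memory. -/
def encountered {α : Type} (a : D.Algorithm α) : Set ℂ :=
  {z | z ∈ (a.run D.initialMemory).2.log}

end LIMDD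

end

/-! ## Bounded dyadic elements of `ℚ(√2, i)` -/

theorem ofReal_sqrt_two_mul_self : ((√2 : ℝ) : ℂ) * ((√2 : ℝ) : ℂ) = 2 := by
  rw [← Complex.ofReal_mul, Real.mul_self_sqrt (by norm_num)]; norm_num

/-- The element `a + b√2 + c i + d i√2`. -/
noncomputable def quadVal (a b c d : ℤ) : ℂ :=
  a + b * ((√2 : ℝ) : ℂ) + c * Complex.I + d * Complex.I * ((√2 : ℝ) : ℂ)

theorem quadVal_im (a b c d : ℤ) : (quadVal a b c d).im = c + d * √2 := by
  simp [quadVal]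

theorem int_add_mul_sqrt_two_eq_zero {a b : ℤ} (h : (a : ℝ) + b * √2 = 0) : a = 0 ∧ b = 0 := by
  have hb : b = 0 := by
    by_contra hb
    have h1 : Irrational ((b : ℝ) * √2) := irrational_sqrt_two.intCast_mul hb
    exact h1 ⟨-a, by push_cast; linarith⟩
  subst hb
  simpa using h

theorem int_add_mul_sqrt_two_inj {a b a' b' : ℤ} (h : (a : ℝ) + b * √2 = a' + b' * √2) :
    a = a' ∧ b = b' := by
  have := int_add_mul_sqrt_two_eq_zero (a := a - a') (b := b - b') (by push_cast; linarith)
  omega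

/-- The numbers `(a + b√2 + c i + d i√2) / 2 ^ m` with integers `a, b, c, d` in `{-B, …, B}`. -/
def DyadicBounded (m B : ℕ) : Set ℂ :=
  {z | ∃ a b c d : ℤ, |a| ≤ B ∧ |b| ≤ B ∧ |c| ≤ B ∧ |d| ≤ B ∧ z = quadVal a b c d / 2 ^ m}

namespace DyadicBounded

variable {m B B' : ℕ} {z w : ℂ}

theorem mono (h : B ≤ B') (hz : z ∈ DyadicBounded m B) : z ∈ DyadicBounded m B' := by
  obtain ⟨a, b, c, d, ha, hb, hc, hd, rfl⟩ := hz
  have : (B : ℤ) ≤ B' := by exact_mod_cast h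
  exact ⟨a, b, c, d, by omega, by omega, by omega, by omega, rfl⟩

theorem zero_mem : (0 : ℂ) ∈ DyadicBounded m B :=
  ⟨0, 0, 0, 0, by simp, by simp, by simp, by simp, by simp [quadVal]⟩

theorem one_div_two_pow : (1 / 2 ^ m : ℂ) ∈ DyadicBounded m 1 :=
  ⟨1, 0, 0, 0, by simp, by simp, by simp, by simp, by simp [quadVal]⟩

theorem add (hz : z ∈ DyadicBounded m B) (hw : w ∈ DyadicBounded m B') :
    z + w ∈ DyadicBounded m (B + B') := by
  obtain ⟨a, b, c, d, ha, hb, hc, hd, rfl⟩ := hz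
  obtain ⟨a', b', c', d', ha', hb', hc', hd', rfl⟩ := hw
  refine ⟨a + a', b + b', c + c', d + d', ?_, ?_, ?_, ?_, ?_⟩
  · push_cast; exact (abs_add_le _ _).trans (by omega)
  · push_cast; exact (abs_add_le _ _).trans (by omega)
  · push_cast; exact (abs_add_le _ _).trans (by omega)
  · push_cast; exact (abs_add_le _ _).trans (by omega)
  · simp only [quadVal]; push_cast; ring

theorem neg (hz : z ∈ DyadicBounded m B) : -z ∈ DyadicBounded m B := by
  obtain ⟨a, b, c, d, ha, hb, hc, hd, rfl⟩ := hz
  refine ⟨-a, -b, -c, -d, by rwa [abs_neg], by rwa [abs_neg], by rwa [abs_neg], by rwa [abs_neg], ?_⟩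
  simp only [quadVal]; push_cast; ring

theorem I_mul (hz : z ∈ DyadicBounded m B) : Complex.I * z ∈ DyadicBounded m B := by
  obtain ⟨a, b, c, d, ha, hb, hc, hd, rfl⟩ := hz
  refine ⟨-c, -d, a, b, by rwa [abs_neg], by rwa [abs_neg], ha, hb, ?_⟩
  simp only [quadVal]; push_cast
  linear_combination ((c : ℂ) + d * ((√2 : ℝ) : ℂ)) / 2 ^ m * Complex.I_mul_I

theorem unit_mul {u : ℂ} (hu : u ^ 4 = 1) (hz : z ∈ DyadicBounded m B) :
    u * z ∈ DyadicBounded m B := by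
  have h : (u - 1) * (u + 1) * ((u - Complex.I) * (u + Complex.I)) = 0 := by
    linear_combination hu + (1 - u ^ 2) * Complex.I_sq
  rcases mul_eq_zero.1 h with h | h <;> rcases mul_eq_zero.1 h with h | h
  · rw [sub_eq_zero.1 h, one_mul]; exact hz
  · rw [eq_neg_of_add_eq_zero_left h, neg_one_mul]; exact neg hz
  · rw [sub_eq_zero.1 h]; exact I_mul hz
  · rw [eq_neg_of_add_eq_zero_left h, neg_mul]; exact neg (I_mul hz)

theorem succ (hz : z ∈ DyadicBounded m B) : z ∈ DyadicBounded (m + 1) (2 * B) := by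
  obtain ⟨a, b, c, d, ha, hb, hc, hd, rfl⟩ := hz
  refine ⟨2 * a, 2 * b, 2 * c, 2 * d, ?_, ?_, ?_, ?_, ?_⟩
  · rw [abs_mul]; push_cast; rw [abs_two]; omega
  · rw [abs_mul]; push_cast; rw [abs_two]; omega
  · rw [abs_mul]; push_cast; rw [abs_two]; omega
  · rw [abs_mul]; push_cast; rw [abs_two]; omega
  · simp only [quadVal]; push_cast; field_simp; ring

theorem half_sqrt_two_mul (hz : z ∈ DyadicBounded m B) :
    ((√2 : ℝ) : ℂ) / 2 * z ∈ DyadicBounded (m + 1) (2 * B) := by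
  obtain ⟨a, b, c, d, ha, hb, hc, hd, rfl⟩ := hz
  refine ⟨2 * b, a, 2 * d, c, ?_, ?_, ?_, ?_, ?_⟩
  · rw [abs_mul]; push_cast; rw [abs_two]; omega
  · push_cast; omega
  · rw [abs_mul]; push_cast; rw [abs_two]; omega
  · push_cast; omega
  · simp only [quadVal]; push_cast
    rw [pow_succ]
    linear_combination ((b : ℂ) + d * Complex.I) / (2 ^ m * 2) * ofReal_sqrt_two_mul_self

theorem sum {ι : Type*} (s : Finset ι) {f : ι → ℂ} (h : ∀ i ∈ s, f i ∈ DyadicBounded m B) :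
    ∑ i ∈ s, f i ∈ DyadicBounded m (s.card * B) := by
  classical
  induction s using Finset.induction_on with
  | empty => exact zero_mem
  | insert i s hi ih =>
    rw [Finset.sum_insert hi, Finset.card_insert_of_notMem hi, add_mul, one_mul, add_comm (_ * _)]
    exact add (h i (by simp)) (ih fun j hj => h j (by simp [hj]))

theorem mem_RNumbers {k : ℕ} (hz : z ∈ DyadicBounded m B) (hm : m ≤ k) (hB : B ≤ 2 ^ k) :
    z ∈ RNumbers k := by
  obtain ⟨a, b, c, d, ha, hb, hc, hd, rfl⟩ := hz
  have hB' : (B : ℤ) ≤ 2 ^ k := by exact_mod_cast hB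
  have key : ∀ a : ℤ, |a| ≤ B → (a : ℚ) / ((2 ^ m : ℤ) : ℚ) ∈ boundedFractions k := fun a ha =>
    ⟨a, 2 ^ m, ha.trans hB', by
      rw [abs_of_nonneg (by positivity)]; exact pow_le_pow_right₀ (by norm_num) hm,
      by positivity, rfl⟩
  refine ⟨_, key a ha, _, key b hb, _, key c hc, _, key d hd, ?_⟩
  simp only [quadVal]; push_cast; ring

theorem div_mem_RNumbers {k : ℕ} {q : ℂ} (hz : z ∈ DyadicBounded m B)
    (hq : q ∈ DyadicBounded m B) (hq_im : q.im = 0) (hq0 : q ≠ 0) (hk : 3 * B ^ 2 ≤ 2 ^ k) :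
    z / q ∈ RNumbers k := by
  obtain ⟨a, b, c, d, ha, hb, hc, hd, rfl⟩ := hz
  obtain ⟨p, r, c', d', hp, hr, -, -, rfl⟩ := hq
  have hcd : c' = 0 ∧ d' = 0 := by
    apply int_add_mul_sqrt_two_eq_zero
    rw [← quadVal_im p r]
    have h2 : (2 ^ m : ℂ) = ((2 ^ m : ℝ) : ℂ) := by push_cast; rfl
    rw [h2, Complex.div_ofReal_im, div_eq_zero_iff] at hq_im
    exact hq_im.resolve_right (by positivity)
  obtain ⟨rfl, rfl⟩ := hcd
  have hk' : 3 * (B : ℤ) ^ 2 ≤ 2 ^ k := by exact_mod_cast hk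
  have hmul : ∀ x y : ℤ, |x| ≤ B → |y| ≤ B → |x * y| ≤ (B : ℤ) ^ 2 := fun x y hx hy => by
    rw [abs_mul, sq]; exact mul_le_mul hx hy (abs_nonneg _) (by positivity)
  have hN : p ^ 2 - 2 * r ^ 2 ≠ 0 := by
    intro h
    have h' : ((p : ℝ) + r * √2) * (p - r * √2) = 0 := by
      have : ((p ^ 2 - 2 * r ^ 2 : ℤ) : ℝ) = 0 := by rw [h]; simp
      push_cast at this
      linear_combination this - r ^ 2 * Real.mul_self_sqrt (show (0 : ℝ) ≤ 2 by norm_num)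
    apply hq0
    rcases mul_eq_zero.1 h' with h' | h'
    · obtain ⟨rfl, rfl⟩ := int_add_mul_sqrt_two_eq_zero h'
      simp [quadVal]
    · obtain ⟨rfl, h1⟩ := int_add_mul_sqrt_two_eq_zero (a := p) (b := -r)
        (by push_cast; linarith)
      obtain rfl : r = 0 := by omega
      simp [quadVal]
  have hNC : (p : ℂ) ^ 2 - 2 * r ^ 2 ≠ 0 := by exact_mod_cast hN
  have hden : (p : ℂ) + r * ((√2 : ℝ) : ℂ) ≠ 0 := by
    intro h
    apply hNC
    linear_combination (p - r * ((√2 : ℝ) : ℂ)) * h + r ^ 2 * ofReal_sqrt_two_mul_self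
  have hNk : |p ^ 2 - 2 * r ^ 2| ≤ 2 ^ k := by
    have h1 := abs_le.1 (hmul p p hp hp)
    have h2 := abs_le.1 (hmul r r hr hr)
    rw [abs_le]
    constructor <;> nlinarith
  have key1 : ∀ a b : ℤ, |a| ≤ B → |b| ≤ B →
      ((a * p - 2 * (b * r) : ℤ) : ℚ) / ((p ^ 2 - 2 * r ^ 2 : ℤ) : ℚ) ∈ boundedFractions k := by
    intro a b ha hb
    refine ⟨_, _, ?_, hNk, hN, rfl⟩
    have h1 := abs_le.1 (hmul a p ha hp)
    have h2 := abs_le.1 (hmul b r hb hr)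
    rw [abs_le]
    constructor <;> linarith
  have key2 : ∀ a b : ℤ, |a| ≤ B → |b| ≤ B →
      ((b * p - a * r : ℤ) : ℚ) / ((p ^ 2 - 2 * r ^ 2 : ℤ) : ℚ) ∈ boundedFractions k := by
    intro a b ha hb
    refine ⟨_, _, ?_, hNk, hN, rfl⟩
    have h1 := abs_le.1 (hmul b p hb hp)
    have h2 := abs_le.1 (hmul a r ha hr)
    have h3 : 0 ≤ (B : ℤ) ^ 2 := by positivity
    rw [abs_le]
    constructor <;> linarith
  refine ⟨_, key1 a b ha hb, _, key2 a b ha hb, _, key1 c d hc hd, _, key2 c d hc hd, ?_⟩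
  simp only [quadVal]
  push_cast
  rw [div_div_div_cancel_right₀ (by simp)]
  simp only [zero_mul, add_zero]
  rw [div_eq_iff hden]
  field_simp
  linear_combination (((a : ℂ) + b * ((√2 : ℝ) : ℂ) + c * Complex.I
    + d * Complex.I * ((√2 : ℝ) : ℂ)) * r ^ 2
    - (b + d * Complex.I) * r * (p + r * ((√2 : ℝ) : ℂ))) * ofReal_sqrt_two_mul_self

end DyadicBounded

/-! ## Pauli expansions of rank-one density matrices -/

/-- The entries of the integer matrix `X ^ p.1 * Z ^ p.2`. -/
def pauliInt (p : Fin 2 × Fin 2) (x y : Fin 2) : ℤ :=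
  if x = y + p.1 then (if p.2 = 1 ∧ y = 1 then -1 else 1) else 0

/-- `|ψ⟩⟨ψ|` is a combination of Pauli strings with coefficients in `DyadicBounded m B`. -/
def HasPauliExpansion {n : ℕ} (m B : ℕ) (ψ : QVec n) : Prop :=
  ∃ c : (Fin n → Fin 2 × Fin 2) → ℂ, (∀ p, c p ∈ DyadicBounded m B) ∧
    ∀ x y, ψ x * (starRingEnd ℂ) (ψ y) =
      ∑ p, c p * ∏ j, (pauliInt (p j) (x j) (y j) : ℂ)

theorem exp_I_pi_div_four : Complex.exp (Complex.I * (Real.pi : ℂ) / 4) =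
    ((√2 : ℝ) : ℂ) / 2 * (1 + Complex.I) := by
  have : Complex.I * (Real.pi : ℂ) / 4 = ((Real.pi / 4 : ℝ) : ℂ) * Complex.I := by
    push_cast; ring
  rw [this, Complex.exp_mul_I, ← Complex.ofReal_cos, ← Complex.ofReal_sin, Real.cos_pi_div_four,
    Real.sin_pi_div_four]
  push_cast; ring

theorem pauliInt_eq (p : Fin 2 × Fin 2) (x y : Fin 2) :
    pauliInt p x y = 0 ∨ pauliInt p x y = 1 ∨ pauliInt p x y = -1 := by
  unfold pauliInt; split_ifs <;> simp

theorem prod_pauliInt {n : ℕ} (p : Fin n → Fin 2 × Fin 2) (x y : Fin n → Fin 2)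
    (s : Finset (Fin n)) :
    ∏ j ∈ s, pauliInt (p j) (x j) (y j) = 0 ∨ (∏ j ∈ s, pauliInt (p j) (x j) (y j)) ^ 4 = 1 := by
  induction s using Finset.induction_on with
  | empty => simp
  | insert i s hi ih =>
    rw [Finset.prod_insert hi, mul_pow]
    rcases pauliInt_eq (p i) (x i) (y i) with h | h | h <;> rw [h] <;> simp <;> exact ih

namespace HasPauliExpansion

variable {n m B m' B' : ℕ} {ψ : QVec n}

theorem mul_conj_mem (h : HasPauliExpansion m B ψ) (x y : Fin n → Fin 2) :
    ψ x * (starRingEnd ℂ) (ψ y) ∈ DyadicBounded m (4 ^ n * B) := by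
  obtain ⟨c, hc, h⟩ := h
  rw [h]
  have h4 : (Finset.univ : Finset (Fin n → Fin 2 × Fin 2)).card = 4 ^ n := by simp
  rw [← h4]
  refine DyadicBounded.sum _ fun p _ => ?_
  rcases prod_pauliInt p x y Finset.univ with h | h
  · rw [← Int.cast_prod, h]; simp [DyadicBounded.zero_mem]
  · rw [mul_comm]
    exact DyadicBounded.unit_mul (by rw [← Int.cast_prod]; exact_mod_cast h) (hc p)

theorem oneQubit (h : HasPauliExpansion m B ψ) (U : Matrix (Fin 2) (Fin 2) ℂ) (i : Fin n)
    (M : Fin 2 × Fin 2 → Fin 2 × Fin 2 → ℂ)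
    (hU : ∀ q x y, ∑ u, ∑ v, U x u * (starRingEnd ℂ) (U y v) * (pauliInt q u v : ℂ) =
      ∑ p, M q p * (pauliInt p x y : ℂ))
    (hM : ∀ c : Fin 2 × Fin 2 → ℂ, (∀ q, c q ∈ DyadicBounded m B) →
      ∀ p, ∑ q, M q p * c q ∈ DyadicBounded m' B') :
    HasPauliExpansion m' B' (applyOneQubit U i ψ) := by
  obtain ⟨c, hc, h⟩ := h
  refine ⟨fun p => ∑ q, M q (p i) * c (Function.update p i q), fun p => hM _ (fun q => hc _) _, ?_⟩
  intro x y
  have hprod : ∀ (p : Fin n → Fin 2 × Fin 2) (q : Fin 2 × Fin 2) (x' y' : Fin n → Fin 2),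
      (∀ j, j ≠ i → x' j = x j ∧ y' j = y j) →
      ∏ j, (pauliInt (Function.update p i q j) (x' j) (y' j) : ℂ) =
        pauliInt q (x' i) (y' i) *
          ∏ j ∈ Finset.univ.erase i, (pauliInt (p j) (x j) (y j) : ℂ) := by
    intro p q x' y' hxy
    rw [← Finset.mul_prod_erase _ _ (Finset.mem_univ i), Function.update_self]
    congr 1
    refine Finset.prod_congr rfl fun j hj => ?_
    have hj := Finset.ne_of_mem_erase hj
    rw [Function.update_of_ne hj, (hxy j hj).1, (hxy j hj).2]
  have hL : applyOneQubit U i ψ x * (starRingEnd ℂ) (applyOneQubit U i ψ y) =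
      ∑ p, c p * (∏ j ∈ Finset.univ.erase i, (pauliInt (p j) (x j) (y j) : ℂ)) *
        ∑ u, ∑ v, U (x i) u * (starRingEnd ℂ) (U (y i) v) * (pauliInt (p i) u v : ℂ) := by
    simp only [applyOneQubit, map_sum, map_mul, Finset.sum_mul_sum]
    have : ∀ u v, U (x i) u * ψ (Function.update x i u) *
        ((starRingEnd ℂ) (U (y i) v) * (starRingEnd ℂ) (ψ (Function.update y i v))) =
        ∑ p, c p * (∏ j ∈ Finset.univ.erase i, (pauliInt (p j) (x j) (y j) : ℂ)) *
          (U (x i) u * (starRingEnd ℂ) (U (y i) v) * (pauliInt (p i) u v : ℂ)) := by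
      intro u v
      rw [mul_mul_mul_comm, h, Finset.mul_sum]
      refine Finset.sum_congr rfl fun p _ => ?_
      have := hprod p (p i) (Function.update x i u) (Function.update y i v)
        (fun j hj => by simp [hj])
      rw [Function.update_eq_self, Function.update_self, Function.update_self] at this
      rw [this]; ring
    simp only [this, Finset.mul_sum]
    rw [Finset.sum_comm' (t' := Finset.univ) (s' := fun _ => Finset.univ) (by simp)]
    rw [Finset.sum_comm]
    conv_lhs => enter [2, v]; rw [Finset.sum_comm]
    rw [Finset.sum_comm]
  rw [hL]
  simp only [hU, Finset.mul_sum, Finset.sum_mul]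
  rw [← Finset.sum_product', ← Finset.sum_product']
  refine Finset.sum_nbij' (fun a => (Function.update a.1 i a.2, a.1 i))
    (fun a => (Function.update a.1 i a.2, a.1 i)) (by simp) (by simp) (by simp) (by simp) ?_
  rintro ⟨p, q⟩ -
  simp only [Function.update_self, Function.update_idem, Function.update_eq_self]
  rw [hprod p q x y (by simp)]
  ring

theorem cnot (h : HasPauliExpansion m B ψ) (c t : Fin n) (hne : c ≠ t) :
    HasPauliExpansion m B ((Gate.CNOT c t hne).apply ψ) := by
  obtain ⟨w, hw, h⟩ := h
  let τ : (Fin n → Fin 2 × Fin 2) → (Fin n → Fin 2 × Fin 2) := fun p =>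
    Function.update (Function.update p t ((p t).1 + (p c).1, (p t).2)) c
      ((p c).1, (p c).2 + (p t).2)
  have hτt : ∀ p, τ p t = ((p t).1 + (p c).1, (p t).2) := fun p => by
    simp only [τ]; rw [Function.update_of_ne hne.symm, Function.update_self]
  have hτc : ∀ p, τ p c = ((p c).1, (p c).2 + (p t).2) := fun p => by
    simp only [τ]; rw [Function.update_self]
  have hτ : ∀ p j, j ≠ t → j ≠ c → τ p j = p j := fun p j h1 h2 => by
    simp only [τ]; rw [Function.update_of_ne h2, Function.update_of_ne h1]
  have two : ∀ a b : Fin 2, a + b + b = a := by decide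
  have hττ : Function.Involutive τ := by
    intro p
    funext j
    by_cases h1 : j = t
    · subst h1; rw [hτt, hτt, hτc]; simp [two]
    by_cases h2 : j = c
    · subst h2; rw [hτc, hτc, hτt]; simp [two]
    rw [hτ _ _ h1 h2, hτ _ _ h1 h2]
  refine ⟨fun p => w (τ p), fun p => hw _, fun x y => ?_⟩
  simp only [Gate.apply]
  rw [h, ← Equiv.sum_comp hττ.toPerm]
  refine Finset.sum_congr rfl fun p _ => ?_
  simp only [Function.Involutive.coe_toPerm]
  congr 1
  have hmem : c ∈ Finset.univ.erase t := by simp [hne]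
  rw [← Finset.mul_prod_erase _ _ (Finset.mem_univ t), ← Finset.mul_prod_erase _ _ hmem,
    ← Finset.mul_prod_erase _ _ (Finset.mem_univ t), ← Finset.mul_prod_erase _ _ hmem,
    ← mul_assoc, ← mul_assoc]
  congr 1
  · rw [hτt, hτc, Function.update_self, Function.update_self, Function.update_of_ne hne,
      Function.update_of_ne hne]
    have : ∀ (p q : Fin 2 × Fin 2) (a b a' b' : Fin 2),
        pauliInt (p.1 + q.1, p.2) (a + b) (a' + b') * pauliInt (q.1, q.2 + p.2) b b' =
          pauliInt p a a' * pauliInt q b b' := by decide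
    exact_mod_cast this (p t) (p c) (x t) (x c) (y t) (y c)
  · refine Finset.prod_congr rfl fun j hj => ?_
    simp only [Finset.mem_erase, Finset.mem_univ, and_true] at hj
    rw [hτ _ _ hj.2 hj.1, Function.update_of_ne hj.2, Function.update_of_ne hj.2]

theorem hadamard (h : HasPauliExpansion m B ψ) (i : Fin n) :
    HasPauliExpansion m B ((Gate.H i).apply ψ) := by
  refine h.oneQubit _ i
    (fun q p => if q = (p.2, p.1) then (if p = (1, 1) then -1 else 1) else 0) ?_ ?_
  · have hs : (((√2 : ℝ) : ℂ))⁻¹ * (((√2 : ℝ) : ℂ))⁻¹ = 1 / 2 := by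
      rw [← mul_inv, ofReal_sqrt_two_mul_self]; norm_num
    rintro ⟨q1, q2⟩ x y
    fin_cases q1 <;> fin_cases q2 <;> fin_cases x <;> fin_cases y <;>
      simp [Fin.sum_univ_two, Fintype.sum_prod_type, pauliInt] <;>
      first
      | linear_combination (2 : ℂ) * hs
      | linear_combination (4 : ℂ) * hs
      | linear_combination (-2 : ℂ) * hs
  · intro c hc p
    have : ∑ q, (if q = (p.2, p.1) then (if p = (1, 1) then (-1 : ℂ) else 1) else 0) * c q =
        (if p = (1, 1) then -1 else 1) * c (p.2, p.1) := by
      simp only [ite_mul, zero_mul]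
      rw [Finset.sum_ite_eq' Finset.univ (p.2, p.1)]
      simp
    rw [this]
    exact DyadicBounded.unit_mul (by split_ifs <;> norm_num) (hc _)

theorem phaseGate (h : HasPauliExpansion m B ψ) (i : Fin n) :
    HasPauliExpansion m B ((Gate.S i).apply ψ) := by
  refine h.oneQubit _ i
    (fun q p => if q = (p.1, p.2 + p.1) then (if p.1 = 1 then Complex.I else 1) else 0) ?_ ?_
  · rintro ⟨q1, q2⟩ x y
    fin_cases q1 <;> fin_cases q2 <;> fin_cases x <;> fin_cases y <;>
      simp [Fin.sum_univ_two, Fintype.sum_prod_type, pauliInt]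
  · intro c hc p
    have : ∑ q, (if q = (p.1, p.2 + p.1) then (if p.1 = 1 then Complex.I else 1) else 0) * c q =
        (if p.1 = 1 then Complex.I else 1) * c (p.1, p.2 + p.1) := by
      simp only [ite_mul, zero_mul]
      rw [Finset.sum_ite_eq' Finset.univ (p.1, p.2 + p.1)]
      simp
    rw [this]
    exact DyadicBounded.unit_mul (by split_ifs <;> simp) (hc _)

theorem tGate (h : HasPauliExpansion m B ψ) (i : Fin n) :
    HasPauliExpansion (m + 1) (4 * B) ((Gate.T i).apply ψ) := by
  refine h.oneQubit _ i
    (fun q p => if q.1 = p.1 then (if p.1 = 0 then (if q.2 = p.2 then 1 else 0)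
      else ((√2 : ℝ) : ℂ) / 2 * (if q.2 = p.2 then 1 else Complex.I)) else 0) ?_ ?_
  · rintro ⟨q1, q2⟩ x y
    have h2 := exp_I_pi_div_four
    have h3 : (starRingEnd ℂ) (Complex.exp (Complex.I * (Real.pi : ℂ) / 4)) =
        ((√2 : ℝ) : ℂ) / 2 * (1 - Complex.I) := by
      have h4 : (starRingEnd ℂ) 2 = 2 := Complex.conj_ofNat 2
      rw [exp_I_pi_div_four, map_mul, map_div₀, map_add, Complex.conj_ofReal, Complex.conj_I,
        map_one, h4]
      ring
    generalize Complex.exp (Complex.I * (Real.pi : ℂ) / 4) = ω at h2 h3 ⊢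
    have h1 : ω * (starRingEnd ℂ) ω = 1 := by
      rw [h3, h2]
      linear_combination (1 / 2 : ℂ) * ofReal_sqrt_two_mul_self
        - ((√2 : ℝ) : ℂ) ^ 2 / 4 * Complex.I_sq
    fin_cases q1 <;> fin_cases q2 <;> fin_cases x <;> fin_cases y <;>
      simp only [Fin.sum_univ_two, Fintype.sum_prod_type, pauliInt] <;> simp <;>
      first
      | linear_combination h1
      | linear_combination -h1
      | linear_combination h2
      | linear_combination h3
      | linear_combination -h3
  · rintro c hc ⟨p1, p2⟩
    fin_cases p1 <;> fin_cases p2 <;>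
      simp [Fin.sum_univ_two, Fintype.sum_prod_type]
    · exact DyadicBounded.mono (by omega) (DyadicBounded.succ (hc _))
    · exact DyadicBounded.mono (by omega) (DyadicBounded.succ (hc _))
    · rw [mul_assoc (((√2 : ℝ) : ℂ) / 2)]
      exact DyadicBounded.mono (by omega) (DyadicBounded.add
        (DyadicBounded.half_sqrt_two_mul (hc _))
        (DyadicBounded.half_sqrt_two_mul (DyadicBounded.I_mul (hc _))))
    · rw [mul_assoc (((√2 : ℝ) : ℂ) / 2)]
      exact DyadicBounded.mono (by omega) (DyadicBounded.add
        (DyadicBounded.half_sqrt_two_mul (DyadicBounded.I_mul (hc _)))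
        (DyadicBounded.half_sqrt_two_mul (hc _)))

theorem initial : HasPauliExpansion n 1 (Pi.single 0 1 : QVec n) := by
  refine ⟨fun p => ∏ j, if (p j).1 = 0 then 1 / 2 else 0, fun p => ?_, fun x y => ?_⟩
  · beta_reduce
    by_cases hp : ∀ j, (p j).1 = 0
    · rw [Finset.prod_congr rfl (fun j _ => if_pos (hp j))]
      simpa using DyadicBounded.one_div_two_pow (m := n)
    · push Not at hp
      obtain ⟨j, hj⟩ := hp
      rw [Finset.prod_eq_zero (Finset.mem_univ j) (if_neg hj)]
      exact DyadicBounded.zero_mem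
  · simp only [← Finset.prod_mul_distrib]
    rw [← Fintype.prod_sum (fun j (q : Fin 2 × Fin 2) =>
      (if q.1 = 0 then (1 / 2 : ℂ) else 0) * (pauliInt q (x j) (y j) : ℂ))]
    have hval : ∀ x y : Fin 2, ∑ q : Fin 2 × Fin 2,
        (if q.1 = 0 then (1 / 2 : ℂ) else 0) * (pauliInt q x y : ℂ) =
          if x = 0 ∧ y = 0 then 1 else 0 := by
      intro x y
      fin_cases x <;> fin_cases y <;>
        simp [Fin.sum_univ_two, Fintype.sum_prod_type, pauliInt]
      all_goals norm_num
    simp only [hval]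
    by_cases hx : ∀ j, x j = 0 ∧ y j = 0
    · obtain rfl : x = 0 := funext fun j => (hx j).1
      obtain rfl : y = 0 := funext fun j => (hx j).2
      simp
    · push Not at hx
      obtain ⟨j, hj⟩ := hx
      rw [Finset.prod_eq_zero (Finset.mem_univ j) (if_neg (by tauto))]
      by_cases h0 : x = 0
      · have : y ≠ 0 := fun h => hj (by rw [h0]; rfl) (by rw [h]; rfl)
        simp [this]
      · simp [h0]

end HasPauliExpansion

/-! ## Amplitudes of Clifford+T circuits -/

theorem hasPauliExpansion_circuitState {n : ℕ} (circuit : List (Gate n)) :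
    HasPauliExpansion (n + tCount circuit) (4 ^ tCount circuit) (circuitState circuit) := by
  induction circuit using List.reverseRecOn with
  | nil => simpa [tCount, circuitState] using HasPauliExpansion.initial (n := n)
  | append_singleton l g ih =>
    have h1 : circuitState (l ++ [g]) = g.apply (circuitState l) := by simp [circuitState]
    have h2 : tCount (l ++ [g]) = tCount l + g.tWeight := by simp [tCount]
    rw [h1, h2]
    cases g with
    | H i => exact ih.hadamard i
    | S i => exact ih.phaseGate i
    | T i =>
      rw [Gate.tWeight, pow_succ, mul_comm (4 ^ _), ← add_assoc]
      exact ih.tGate i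
    | CNOT c t hne => exact ih.cnot c t hne

theorem Gate.apply_ne_zero {n : ℕ} (g : Gate n) {ψ : QVec n} (h : ψ ≠ 0) : g.apply ψ ≠ 0 := by
  have one : ∀ (U V : Matrix (Fin 2) (Fin 2) ℂ) (i : Fin n), V * U = 1 →
      applyOneQubit U i ψ ≠ 0 := by
    intro U V i hVU h0
    apply h
    funext x
    have hz : ∀ y, ∑ b, U (y i) b * ψ (Function.update y i b) = 0 := fun y => congrFun h0 y
    have h1 : ∑ u, V (x i) u * ∑ b, U u b * ψ (Function.update x i b) = 0 := by
      refine Finset.sum_eq_zero fun u _ => ?_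
      have := hz (Function.update x i u)
      simp only [Function.update_self, Function.update_idem] at this
      rw [this, mul_zero]
    simp only [Finset.mul_sum, ← mul_assoc] at h1
    rw [Finset.sum_comm] at h1
    simp only [← Finset.sum_mul, ← Matrix.mul_apply, hVU, Matrix.one_apply, ite_mul, one_mul,
      zero_mul, Finset.sum_ite_eq, Finset.mem_univ, if_true, Function.update_eq_self] at h1
    exact h1
  cases g with
  | H i =>
    refine one _ (((√2 : ℝ) / 2 : ℂ) • !![1, 1; 1, -1]) i ?_
    have : ((√2 : ℝ) : ℂ) ≠ 0 := by simp
    ext x y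
    fin_cases x <;> fin_cases y <;> simp [Matrix.mul_apply, Fin.sum_univ_two] <;> field_simp <;>
      norm_num
  | S i =>
    refine one _ !![1, 0; 0, -Complex.I] i ?_
    ext x y
    fin_cases x <;> fin_cases y <;> simp [Matrix.mul_apply, Fin.sum_univ_two]
  | T i =>
    refine one _ !![1, 0; 0, (Complex.exp (Complex.I * (Real.pi : ℂ) / 4))⁻¹] i ?_
    ext x y
    fin_cases x <;> fin_cases y <;> simp [Matrix.mul_apply, Fin.sum_univ_two]
  | CNOT c t hne =>
    intro h0
    apply h
    funext x
    have := congrFun h0 (Function.update x t (x t + x c))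
    simp only [Gate.apply, Function.update_self, Function.update_of_ne hne,
      Function.update_idem, Pi.zero_apply] at this
    have two : ∀ a b : Fin 2, a + b + b = a := by decide
    rwa [two, Function.update_eq_self] at this

theorem circuitState_ne_zero {n : ℕ} (circuit : List (Gate n)) : circuitState circuit ≠ 0 := by
  induction circuit using List.reverseRecOn with
  | nil =>
    intro h
    simpa [circuitState] using congrFun h 0
  | append_singleton l g ih =>
    have h1 : circuitState (l ++ [g]) = g.apply (circuitState l) := by simp [circuitState]
    rw [h1]
    exact g.apply_ne_zero ih

/-- The cyclotomic integer `a + b ω + c ω² + d ω³` with `ω = (1 + i) / √2`. -/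
noncomputable def cyclotomicVal (a b c d : ℤ) : ℂ :=
  a + b * (((√2 : ℝ) : ℂ) / 2 * (1 + Complex.I)) + c * Complex.I
    + d * (((√2 : ℝ) : ℂ) / 2 * (1 + Complex.I)) * Complex.I

theorem sqrt_two_mul_cyclotomicVal (a b c d : ℤ) :
    ((√2 : ℝ) : ℂ) * cyclotomicVal a b c d = cyclotomicVal (b - d) (a + c) (b + d) (c - a) := by
  simp only [cyclotomicVal]
  push_cast
  linear_combination ((b + d * Complex.I) * (1 + Complex.I) / 2) * ofReal_sqrt_two_mul_self
    + (d - ((c : ℂ) - a) * ((√2 : ℝ) : ℂ) / 2) * Complex.I_sq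

theorem cyclotomicVal_mul_conj (a b c d : ℤ) :
    cyclotomicVal a b c d * (starRingEnd ℂ) (cyclotomicVal a b c d) =
      ((a ^ 2 + b ^ 2 + c ^ 2 + d ^ 2 : ℤ) : ℂ)
        + ((a * b + b * c + c * d - d * a : ℤ) : ℂ) * ((√2 : ℝ) : ℂ) := by
  have h : (√2 : ℝ) * √2 = 2 := Real.mul_self_sqrt (by norm_num)
  have hre : (cyclotomicVal a b c d).re = a + (b - d) * (√2 / 2) := by
    simp [cyclotomicVal]; ring
  have him : (cyclotomicVal a b c d).im = c + (b + d) * (√2 / 2) := by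
    simp [cyclotomicVal]; ring
  rw [Complex.mul_conj, Complex.normSq_apply, hre, him]
  norm_cast
  push_cast
  linear_combination ((b : ℝ) ^ 2 + d ^ 2) / 2 * h

/-- All entries of `ψ` lie in `ℤ[ω] / √2 ^ K`. -/
def HasCyclotomicEntries {n : ℕ} (K : ℕ) (ψ : QVec n) : Prop :=
  ∀ x, ∃ a b c d : ℤ, ψ x * ((√2 : ℝ) : ℂ) ^ K = cyclotomicVal a b c d

theorem Gate.hasCyclotomicEntries {n K : ℕ} (g : Gate n) {ψ : QVec n}
    (h : HasCyclotomicEntries K ψ) : ∃ K', HasCyclotomicEntries K' (g.apply ψ) := by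
  cases g with
  | H i =>
    refine ⟨K + 1, fun x => ?_⟩
    obtain ⟨a, b, c, d, h0⟩ := h (Function.update x i 0)
    obtain ⟨a', b', c', d', h1⟩ := h (Function.update x i 1)
    have hs : ((√2 : ℝ) : ℂ) ≠ 0 := by simp
    have hx : x i = 0 ∨ x i = 1 := by generalize x i = b; revert b; decide
    rcases hx with hx | hx
    · refine ⟨a + a', b + b', c + c', d + d', ?_⟩
      have : cyclotomicVal (a + a') (b + b') (c + c') (d + d') =
          cyclotomicVal a b c d + cyclotomicVal a' b' c' d' := by
        simp only [cyclotomicVal]; push_cast; ring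
      rw [this, ← h0, ← h1, pow_succ]
      simp [Gate.apply, applyOneQubit, hx, Fin.sum_univ_two]
      field_simp
    · refine ⟨a - a', b - b', c - c', d - d', ?_⟩
      have : cyclotomicVal (a - a') (b - b') (c - c') (d - d') =
          cyclotomicVal a b c d - cyclotomicVal a' b' c' d' := by
        simp only [cyclotomicVal]; push_cast; ring
      rw [this, ← h0, ← h1, pow_succ]
      simp [Gate.apply, applyOneQubit, hx, Fin.sum_univ_two]
      field_simp
      ring
  | S i =>
    refine ⟨K, fun x => ?_⟩
    obtain ⟨a, b, c, d, h0⟩ := h x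
    have hx : x i = 0 ∨ x i = 1 := by generalize x i = b; revert b; decide
    rcases hx with hx | hx
    · refine ⟨a, b, c, d, ?_⟩
      rw [← h0]
      have : Function.update x i 0 = x := by rw [← hx, Function.update_eq_self]
      simp [Gate.apply, applyOneQubit, hx, Fin.sum_univ_two, this]
    · refine ⟨-c, -d, a, b, ?_⟩
      have : Function.update x i 1 = x := by rw [← hx, Function.update_eq_self]
      have h2 : cyclotomicVal (-c) (-d) a b = Complex.I * cyclotomicVal a b c d := by
        simp only [cyclotomicVal]; push_cast
        linear_combination (-(c : ℂ) - d * (((√2 : ℝ) : ℂ) / 2 * (1 + Complex.I))) * Complex.I_sq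
      rw [h2, ← h0]
      simp [Gate.apply, applyOneQubit, hx, Fin.sum_univ_two, this]
      ring
  | T i =>
    refine ⟨K, fun x => ?_⟩
    obtain ⟨a, b, c, d, h0⟩ := h x
    have hx : x i = 0 ∨ x i = 1 := by generalize x i = b; revert b; decide
    rcases hx with hx | hx
    · refine ⟨a, b, c, d, ?_⟩
      rw [← h0]
      have : Function.update x i 0 = x := by rw [← hx, Function.update_eq_self]
      simp [Gate.apply, applyOneQubit, hx, Fin.sum_univ_two, this]
    · refine ⟨-d, a, b, c, ?_⟩
      have : Function.update x i 1 = x := by rw [← hx, Function.update_eq_self]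
      have hω : (((√2 : ℝ) : ℂ) / 2 * (1 + Complex.I)) ^ 2 = Complex.I := by
        linear_combination (1 + Complex.I) ^ 2 / 4 * ofReal_sqrt_two_mul_self
          + (1 / 2 : ℂ) * Complex.I_sq
      have h2 : cyclotomicVal (-d) a b c =
          ((√2 : ℝ) : ℂ) / 2 * (1 + Complex.I) * cyclotomicVal a b c d := by
        simp only [cyclotomicVal]; push_cast
        generalize ((√2 : ℝ) : ℂ) / 2 * (1 + Complex.I) = ω at hω
        linear_combination (-(b : ℂ) - d * Complex.I) * hω - d * Complex.I_sq
      rw [h2, ← h0]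
      simp [Gate.apply, applyOneQubit, hx, Fin.sum_univ_two, this, exp_I_pi_div_four]
      ring
  | CNOT c t hne => exact ⟨K, fun x => h _⟩

theorem exists_hasCyclotomicEntries_circuitState {n : ℕ} (circuit : List (Gate n)) :
    ∃ K, HasCyclotomicEntries K (circuitState circuit) := by
  induction circuit using List.reverseRecOn with
  | nil =>
    refine ⟨0, fun x => ?_⟩
    by_cases hx : x = 0
    · exact ⟨1, 0, 0, 0, by simp [circuitState, cyclotomicVal, hx]⟩
    · exact ⟨0, 0, 0, 0, by simp [circuitState, cyclotomicVal, hx]⟩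
  | append_singleton l g ih =>
    have h1 : circuitState (l ++ [g]) = g.apply (circuitState l) := by simp [circuitState]
    obtain ⟨K, hK⟩ := ih
    rw [h1]
    exact g.hasCyclotomicEntries hK

/-- A cyclotomic number with denominator a power of `√2` whose squared modulus has a small
denominator has itself a small denominator. -/
theorem mem_dyadicBounded_of_mul_conj_mem {m B : ℕ} {z : ℂ}
    (hz : z * (starRingEnd ℂ) z ∈ DyadicBounded m B) :
    ∀ (j : ℕ) {a b c d : ℤ}, z * ((√2 : ℝ) : ℂ) ^ (2 * m + j) = cyclotomicVal a b c d →
      z ∈ DyadicBounded (m + 1) (2 ^ (m + 1) * B) := by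
  obtain ⟨p, q, r, s, hp, -, -, -, hpq⟩ := hz
  have hrs : r = 0 ∧ s = 0 := by
    apply int_add_mul_sqrt_two_eq_zero
    have h2 : (2 ^ m : ℂ) = ((2 ^ m : ℝ) : ℂ) := by push_cast; rfl
    have := congrArg Complex.im hpq
    rw [Complex.mul_conj, Complex.ofReal_im, h2, Complex.div_ofReal_im, eq_comm,
      div_eq_zero_iff] at this
    rw [← quadVal_im p q]
    exact this.resolve_right (by positivity)
  obtain ⟨rfl, rfl⟩ := hrs
  have key : ∀ (j : ℕ) {a b c d : ℤ},
      z * ((√2 : ℝ) : ℂ) ^ (2 * m + j) = cyclotomicVal a b c d →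
      a ^ 2 + b ^ 2 + c ^ 2 + d ^ 2 = 2 ^ (m + j) * p ∧
        a * b + b * c + c * d - d * a = 2 ^ (m + j) * q := by
    intro j a b c d h
    have h1 := cyclotomicVal_mul_conj a b c d
    rw [← h, map_mul, map_pow, Complex.conj_ofReal, mul_mul_mul_comm, ← mul_pow,
      ofReal_sqrt_two_mul_self, hpq] at h1
    apply int_add_mul_sqrt_two_inj
    have h2 := congrArg Complex.re h1
    have h3 : quadVal p q 0 0 / 2 ^ m * 2 ^ (2 * m + j) =
        ((2 ^ (m + j) * (p + q * √2) : ℝ) : ℂ) := by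
      have : (2 : ℂ) ^ (2 * m + j) = 2 ^ m * 2 ^ (m + j) := by rw [← pow_add]; congr 1; omega
      rw [this, ← mul_assoc, div_mul_cancel₀ _ (by simp)]
      simp only [quadVal]
      push_cast; ring
    rw [h3, Complex.ofReal_re, ← Complex.ofReal_intCast, ← Complex.ofReal_intCast,
      ← Complex.ofReal_mul, ← Complex.ofReal_add, Complex.ofReal_re] at h2
    rw [← h2]; push_cast; ring
  intro j
  induction j with
  | zero =>
    intro a b c d h
    have hN := (key 0 h).1
    rw [add_zero] at h hN
    rw [pow_mul, sq, ofReal_sqrt_two_mul_self] at h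
    have hle : ∀ x : ℤ, x ^ 2 ≤ 2 ^ m * p → |x| ≤ 2 ^ m * B := fun x hx => by
      have h1 : |x| ≤ |x| ^ 2 := by
        rcases (abs_nonneg x).eq_or_lt with h0 | h0
        · rw [← h0]; norm_num
        · nlinarith
      rw [sq_abs] at h1
      refine (h1.trans hx).trans ?_
      gcongr
      exact (le_abs_self p).trans hp
    have ha := hle a (by nlinarith [sq_nonneg b, sq_nonneg c, sq_nonneg d])
    have hb := hle b (by nlinarith [sq_nonneg a, sq_nonneg c, sq_nonneg d])
    have hc := hle c (by nlinarith [sq_nonneg b, sq_nonneg a, sq_nonneg d])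
    have hd := hle d (by nlinarith [sq_nonneg b, sq_nonneg c, sq_nonneg a])
    have hB : ((2 ^ (m + 1) * B : ℕ) : ℤ) = 2 * (2 ^ m * B) := by push_cast; ring
    rw [abs_le] at ha hb hc hd
    refine ⟨2 * a, b - d, 2 * c, b + d, ?_, ?_, ?_, ?_, ?_⟩
    · rw [hB, abs_le]; constructor <;> linarith
    · rw [hB, abs_le]; constructor <;> linarith
    · rw [hB, abs_le]; constructor <;> linarith
    · rw [hB, abs_le]; constructor <;> linarith
    · rw [eq_div_iff (by simp), pow_succ, ← mul_assoc, h]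
      simp only [quadVal, cyclotomicVal]; push_cast
      linear_combination (d : ℂ) * ((√2 : ℝ) : ℂ) * Complex.I_sq
  | succ j ih =>
    intro a b c d h
    obtain ⟨h1, h2⟩ := key (j + 1) h
    have h3 : Even (a + c + (b + d)) := by
      have : Even (a ^ 2 + b ^ 2 + c ^ 2 + d ^ 2) := by
        rw [h1, ← add_assoc, pow_succ]; simp
      simp only [Int.even_add, Int.even_pow] at this ⊢
      tauto
    have h4 : Even ((a + c) * (b + d)) := by
      have : (a + c) * (b + d) = 2 ^ (m + (j + 1)) * q + 2 * (d * a) := by rw [← h2]; ring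
      rw [this, ← add_assoc, pow_succ]
      simp [Int.even_add]
    have h5 : Even (a + c) ∧ Even (b + d) := by
      rw [Int.even_mul] at h4
      rw [Int.even_add] at h3
      tauto
    obtain ⟨⟨y, hy⟩, ⟨w, hw⟩⟩ := h5
    have hs : ((√2 : ℝ) : ℂ) ≠ 0 := by simp
    refine ih (a := b - w) (b := y) (c := w) (d := y - a) (mul_left_cancel₀ hs ?_)
    rw [sqrt_two_mul_cyclotomicVal, show y - (y - a) = a by ring, show b - w + w = b by ring,
      show y + (y - a) = c by omega, show w - (b - w) = d by omega, ← h]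
    ring

/-- The amplitudes of `φ`, their ratios, and the ratios of sums of squared amplitudes lie in `R`. -/
structure AmplitudeRatiosIn {n : ℕ} (φ : QVec n) (R : Set ℂ) : Prop where
  unit_mul : ∀ {u : ℂ} (x), u ^ 4 = 1 → u * φ x ∈ R
  unit_mul_div : ∀ {u : ℂ} (x) {y}, u ^ 4 = 1 → φ y ≠ 0 → u * φ x / φ y ∈ R
  sum : ∀ S : Finset (Fin n → Fin 2), ((∑ x ∈ S, Complex.normSq (φ x) : ℝ) : ℂ) ∈ R
  sum_div : ∀ (S : Finset (Fin n → Fin 2)) {T : Finset (Fin n → Fin 2)},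
    (∑ x ∈ T, Complex.normSq (φ x)) ≠ 0 →
    (((∑ x ∈ S, Complex.normSq (φ x)) / (∑ x ∈ T, Complex.normSq (φ x)) : ℝ) : ℂ) ∈ R

theorem amplitudeRatiosIn_circuitState {n : ℕ} (circuit : List (Gate (n + 1))) :
    AmplitudeRatiosIn (circuitState circuit) (RNumbers (8 * ((n + 1) + tCount circuit))) := by
  have hE := hasPauliExpansion_circuitState circuit
  obtain ⟨K, hK⟩ := exists_hasCyclotomicEntries_circuitState circuit
  generalize circuitState circuit = φ at hE hK
  generalize tCount circuit = t at hE
  have hB : 4 ^ (n + 1) * 4 ^ t ≤ 2 ^ (n + 1) * (4 ^ (n + 1) * 4 ^ t) :=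
    Nat.le_mul_of_pos_left _ (by positivity)
  have h4 : ∀ k, 4 ^ k = 2 ^ (2 * k) := fun k => by rw [pow_mul]; norm_num
  have hρ : ∀ x y, φ x * (starRingEnd ℂ) (φ y) ∈
      DyadicBounded (n + 1 + t) (2 ^ (n + 1) * (4 ^ (n + 1) * 4 ^ t)) := fun x y =>
    DyadicBounded.mono hB (hE.mul_conj_mem x y)
  have hsum : ∀ S : Finset (Fin (n + 1) → Fin 2), ((∑ x ∈ S, Complex.normSq (φ x) : ℝ) : ℂ) ∈
      DyadicBounded (n + 1 + t) (2 ^ (n + 1) * (4 ^ (n + 1) * 4 ^ t)) := by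
    intro S
    push_cast
    simp only [← Complex.mul_conj]
    refine DyadicBounded.mono ?_ (DyadicBounded.sum S fun x _ => hE.mul_conj_mem x x)
    gcongr
    simpa using S.card_le_univ
  have hk : 3 * (2 ^ (n + 1) * (4 ^ (n + 1) * 4 ^ t)) ^ 2 ≤ 2 ^ (8 * ((n + 1) + t)) := by
    calc 3 * (2 ^ (n + 1) * (4 ^ (n + 1) * 4 ^ t)) ^ 2
        ≤ 2 ^ 2 * (2 ^ (n + 1) * (4 ^ (n + 1) * 4 ^ t)) ^ 2 := by gcongr; norm_num
      _ = 2 ^ (2 + ((n + 1) + (2 * (n + 1) + 2 * t)) * 2) := by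
        rw [h4, h4, ← pow_add, ← pow_add, ← pow_mul, ← pow_add]
      _ ≤ 2 ^ (8 * ((n + 1) + t)) := Nat.pow_le_pow_right (by norm_num) (by omega)
  constructor
  · intro u x hu
    obtain ⟨a, b, c, d, h⟩ := hK x
    have h' : φ x * ((√2 : ℝ) : ℂ) ^ (2 * (n + 1 + t) + K) =
        cyclotomicVal (2 ^ (n + 1 + t) * a) (2 ^ (n + 1 + t) * b) (2 ^ (n + 1 + t) * c)
          (2 ^ (n + 1 + t) * d) := by
      rw [pow_add, pow_mul, sq, ofReal_sqrt_two_mul_self, mul_left_comm, h]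
      simp only [cyclotomicVal]; push_cast; ring
    have := mem_dyadicBounded_of_mul_conj_mem (hE.mul_conj_mem x x) K h'
    refine DyadicBounded.mem_RNumbers (DyadicBounded.unit_mul hu this) (by omega) ?_
    rw [h4, h4, ← pow_add, ← pow_add]
    exact Nat.pow_le_pow_right (by norm_num) (by omega)
  · intro u x y hu hy
    have hy' : (starRingEnd ℂ) (φ y) ≠ 0 := by simpa using hy
    have : u * φ x / φ y = u * (φ x * (starRingEnd ℂ) (φ y)) / (φ y * (starRingEnd ℂ) (φ y)) := by
      field_simp
    rw [this]
    exact DyadicBounded.div_mem_RNumbers (DyadicBounded.unit_mul hu (hρ x y)) (hρ y y)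
      (by rw [Complex.mul_conj, Complex.ofReal_im]) (mul_ne_zero hy hy') hk
  · intro S
    refine DyadicBounded.mem_RNumbers (hsum S) (by omega) ?_
    rw [h4, h4, ← pow_add, ← pow_add]
    exact Nat.pow_le_pow_right (by norm_num) (by omega)
  · intro S T hT
    rw [Complex.ofReal_div]
    exact DyadicBounded.div_mem_RNumbers (hsum S) (hsum T) (Complex.ofReal_im _)
      (Complex.ofReal_ne_zero.2 hT) hk

/-! ## Vectors represented by LIMDD nodes -/

theorem Pauli.mat_column_pow_four (P : Pauli) (j : Fin 2) : P.mat j (P.column j) ^ 4 = 1 := by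
  cases P <;> fin_cases j <;> simp [Pauli.mat, Pauli.column, Even.neg_pow (show Even 4 by decide)]

theorem Pauli.mat_apply (P : Pauli) (j k : Fin 2) :
    P.mat j k = if k = P.column j then P.mat j (P.column j) else 0 := by
  cases P <;> fin_cases j <;> fin_cases k <;> simp [Pauli.mat, Pauli.column]

theorem Pauli.column_column (P : Pauli) (j : Fin 2) : P.column (P.column j) = j := by
  cases P <;> fin_cases j <;> simp [Pauli.column]

theorem Pauli.mulPhase_pow_four (P Q : Pauli) : Pauli.mulPhase P Q ^ 4 = 1 := by
  cases P <;> cases Q <;> simp [Pauli.mulPhase, Even.neg_pow (show Even 4 by decide)]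

theorem normSq_of_pow_four {u : ℂ} (hu : u ^ 4 = 1) : Complex.normSq u = 1 := by
  have h : ‖u‖ = 1 := Complex.norm_eq_one_of_pow_eq_one hu (by norm_num)
  rw [Complex.normSq_eq_norm_sq, h, one_pow]

namespace PauliLIM

variable {m : ℕ}

/-- The column of the only nonzero entry of row `x` of a Pauli string. -/
def column (s : Fin m → Pauli) (x : Fin m → Fin 2) : Fin m → Fin 2 := fun i => (s i).column (x i)

/-- The only nonzero entry of row `x` of a Pauli string. -/
noncomputable def entry (s : Fin m → Pauli) (x : Fin m → Fin 2) : ℂ :=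
  ∏ i, (s i).mat (x i) ((s i).column (x i))

theorem column_involutive (s : Fin m → Pauli) : Function.Involutive (column s) := fun x =>
  funext fun i => (s i).column_column (x i)

theorem entry_pow_four (s : Fin m → Pauli) (x : Fin m → Fin 2) : entry s x ^ 4 = 1 := by
  rw [entry, ← Finset.prod_pow]
  exact Finset.prod_eq_one fun i _ => Pauli.mat_column_pow_four _ _

theorem phase_pow_four (A B : PauliLIM m) : phase A B ^ 4 = 1 := by
  rw [phase, ← Finset.prod_pow]
  exact Finset.prod_eq_one fun i _ => Pauli.mulPhase_pow_four _ _

theorem phase_identity (c : ℂ) (B : PauliLIM m) : phase ⟨c, fun _ => .I⟩ B = 1 :=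
  Finset.prod_eq_one fun i _ => by
    change Pauli.mulPhase .I (B.string i) = 1
    cases B.string i <;> rfl

theorem toMatrix_mulVec (A : PauliLIM m) (ψ : QVec m) (x : Fin m → Fin 2) :
    A.toMatrix.mulVec ψ x = A.coeff * entry A.string x * ψ (column A.string x) := by
  rw [Matrix.mulVec, dotProduct, Finset.sum_eq_single (column A.string x)]
  · rfl
  · intro y _ hy
    have : ∃ i, y i ≠ (A.string i).column (x i) := by
      by_contra! h
      exact hy (funext h)
    obtain ⟨i, hi⟩ := this
    rw [toMatrix, Finset.prod_eq_zero (Finset.mem_univ i), mul_zero, zero_mul]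
    rw [Pauli.mat_apply, if_neg hi]
  · simp

end PauliLIM

/-- Up to a nonzero factor and fourth roots of unity, `ψ` is a subvector of `φ`. -/
def IsSubvector {n m : ℕ} (φ : QVec n) (ψ : QVec m) : Prop :=
  ∃ (f : (Fin m → Fin 2) → (Fin n → Fin 2)) (u : (Fin m → Fin 2) → ℂ) (μ : ℂ),
    Function.Injective f ∧ (∀ x, u x ^ 4 = 1) ∧ μ ≠ 0 ∧ ∀ x, φ (f x) = μ * (u x * ψ x)

theorem ne_zero_of_pow_four {u : ℂ} (hu : u ^ 4 = 1) : u ≠ 0 := by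
  rintro rfl; norm_num at hu

theorem inv_pow_four {u : ℂ} (hu : u ^ 4 = 1) : u⁻¹ ^ 4 = 1 := by rw [inv_pow, hu, inv_one]

theorem mul_pow_four {u v : ℂ} (hu : u ^ 4 = 1) (hv : v ^ 4 = 1) : (u * v) ^ 4 = 1 := by
  rw [mul_pow, hu, hv, one_mul]

namespace IsSubvector

variable {n m k : ℕ} {φ : QVec n} {ψ : QVec m} {R : Set ℂ}

theorem comp (h : IsSubvector φ ψ) {χ : QVec k} (g : (Fin k → Fin 2) → (Fin m → Fin 2))
    (hg : Function.Injective g) (w : (Fin k → Fin 2) → ℂ) (hw : ∀ x, w x ^ 4 = 1) {c : ℂ}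
    (hc : c ≠ 0) (hχ : ∀ x, ψ (g x) = c * (w x * χ x)) : IsSubvector φ χ := by
  obtain ⟨f, u, μ, hf, hu, hμ, h⟩ := h
  refine ⟨f ∘ g, fun x => u (g x) * w x, μ * c, hf.comp hg, fun x => mul_pow_four (hu _) (hw _),
    mul_ne_zero hμ hc, fun x => ?_⟩
  rw [Function.comp_apply, h, hχ]; ring

theorem unit_mul_mem (h : IsSubvector φ ψ) (hR : AmplitudeRatiosIn φ R) {x₀ : Fin m → Fin 2}
    (h₀ : ψ x₀ = 1) {w : ℂ} (hw : w ^ 4 = 1) (x : Fin m → Fin 2) : w * ψ x ∈ R := by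
  obtain ⟨f, u, μ, hf, hu, hμ, h⟩ := h
  have h0 := ne_zero_of_pow_four (hu x₀)
  have hx := ne_zero_of_pow_four (hu x)
  have hne : φ (f x₀) ≠ 0 := by rw [h, h₀]; simp [hμ, h0]
  have key := hR.unit_mul_div (f x)
    (mul_pow_four (mul_pow_four hw (hu x₀)) (inv_pow_four (hu x))) hne
  rw [h, h, h₀] at key
  convert key using 1
  field_simp

theorem sum_mem (h : IsSubvector φ ψ) (hR : AmplitudeRatiosIn φ R) {x₀ : Fin m → Fin 2}
    (h₀ : ψ x₀ = 1) (S : Finset (Fin m → Fin 2)) :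
    ((∑ x ∈ S, Complex.normSq (ψ x) : ℝ) : ℂ) ∈ R := by
  obtain ⟨f, u, μ, hf, hu, hμ, h⟩ := h
  have hμ' : Complex.normSq μ ≠ 0 := by simpa using hμ
  have hn : ∀ x, Complex.normSq (φ (f x)) = Complex.normSq μ * Complex.normSq (ψ x) := fun x => by
    rw [h, Complex.normSq_mul, Complex.normSq_mul, normSq_of_pow_four (hu x), one_mul]
  have key := hR.sum_div (S.image f) (T := {f x₀}) (by rw [Finset.sum_singleton, hn, h₀]; simpa)
  rw [Finset.sum_singleton, Finset.sum_image (fun a _ b _ hab => hf hab), hn x₀, h₀] at key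
  simp only [hn, ← Finset.mul_sum] at key
  rw [map_one, mul_one, mul_div_cancel_left₀ _ hμ'] at key
  exact key

end IsSubvector

namespace LIMDD

open PauliLIM

variable {n : ℕ} {D : LIMDD n}

theorem nodeVec_cons_zero {m : ℕ} (v : D.Node (m + 1)) (x : Fin m → Fin 2) :
    D.nodeVec v (Fin.cons 0 x) = (D.lowLabel v).coeff *
      (entry (D.lowLabel v).string x * D.nodeVec (D.low v) (column (D.lowLabel v).string x)) := by
  rw [nodeVec, ← mul_assoc, ← toMatrix_mulVec]; simp

theorem nodeVec_cons_one {m : ℕ} (v : D.Node (m + 1)) (x : Fin m → Fin 2) :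
    D.nodeVec v (Fin.cons 1 x) = (D.highLabel v).coeff *
      (entry (D.highLabel v).string x * D.nodeVec (D.high v) (column (D.highLabel v).string x)) := by
  rw [nodeVec, ← mul_assoc, ← toMatrix_mulVec]; simp

/-- The low (`y = 0`) or high (`y = 1`) edge of a node. -/
noncomputable def childEdge {m : ℕ} (v : D.Node (m + 1)) (y : Fin 2) : D.Edge m :=
  if y = 0 then D.lowEdge v else D.highEdge v

theorem nodeVec_cons {m : ℕ} (v : D.Node (m + 1)) (y : Fin 2) (x : Fin m → Fin 2) :
    D.nodeVec v (Fin.cons y x) = (D.childEdge v y).label.coeff *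
      (entry (D.childEdge v y).label.string x *
        D.nodeVec (D.childEdge v y).target (column (D.childEdge v y).label.string x)) := by
  fin_cases y
  · exact nodeVec_cons_zero v x
  · exact nodeVec_cons_one v x

theorem edgeVec_eq {m : ℕ} (e : D.Edge m) (x : Fin m → Fin 2) :
    D.edgeVec e x = e.label.coeff *
      (entry e.label.string x * D.nodeVec e.target (column e.label.string x)) := by
  rw [edgeVec, toMatrix_mulVec, mul_assoc]

theorem IsNormalized.exists_nodeVec_eq_one (hD : D.IsNormalized) :
    ∀ {m : ℕ} (v : D.Node m), ∃ x, D.nodeVec v x = 1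
  | 0, _ => ⟨0, by rw [nodeVec]⟩
  | m + 1, v => by
    have hI : ∀ x : Fin m → Fin 2, entry (PauliLIM.one m).string x = 1 ∧
        column (PauliLIM.one m).string x = x := fun x =>
      ⟨Finset.prod_eq_one fun i _ => by
        change Pauli.mat .I (x i) (x i) = 1
        generalize x i = j
        fin_cases j <;> simp [Pauli.mat], rfl⟩
    rcases hD.factoring v with h | ⟨-, h⟩
    · obtain ⟨x, hx⟩ := hD.exists_nodeVec_eq_one (D.low v)
      refine ⟨Fin.cons 0 x, ?_⟩
      rw [nodeVec_cons_zero, h, (hI x).1, (hI x).2, hx]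
      simp [PauliLIM.one]
    · obtain ⟨x, hx⟩ := hD.exists_nodeVec_eq_one (D.high v)
      refine ⟨Fin.cons 1 x, ?_⟩
      rw [nodeVec_cons_one, h, (hI x).1, (hI x).2, hx]
      simp [PauliLIM.one]

theorem isSubvector_child_of_coeff_ne_zero {φ : QVec n} {m : ℕ} {v : D.Node (m + 1)}
    (h : IsSubvector φ (D.nodeVec v)) (y : Fin 2) (hy : (D.childEdge v y).label.coeff ≠ 0) :
    IsSubvector φ (D.nodeVec (D.childEdge v y).target) := by
  refine h.comp (fun x => Fin.cons y (column (D.childEdge v y).label.string x)) ?_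
    (fun x => entry (D.childEdge v y).label.string (column (D.childEdge v y).label.string x))
    (fun x => entry_pow_four _ _) hy fun x => ?_
  · intro a b hab
    exact (column_involutive _).injective (Fin.cons_right_injective _ hab)
  · rw [nodeVec_cons, column_involutive]

theorem IsNormalized.isSubvector_child (hD : D.IsNormalized) {φ : QVec n} {m : ℕ}
    {v : D.Node (m + 1)} (h : IsSubvector φ (D.nodeVec v)) (y : Fin 2) :
    IsSubvector φ (D.nodeVec (D.childEdge v y).target) := by
  have h0 := isSubvector_child_of_coeff_ne_zero h 0
  have h1 := isSubvector_child_of_coeff_ne_zero h 1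
  simp only [childEdge, if_true, one_ne_zero, if_false] at h0 h1
  change (D.lowLabel v).coeff ≠ 0 → IsSubvector φ (D.nodeVec (D.low v)) at h0
  change (D.highLabel v).coeff ≠ 0 → IsSubvector φ (D.nodeVec (D.high v)) at h1
  suffices IsSubvector φ (D.nodeVec (D.low v)) ∧ IsSubvector φ (D.nodeVec (D.high v)) by
    unfold childEdge
    split_ifs
    exacts [this.1, this.2]
  by_cases hl : (D.lowLabel v).coeff = 0
  · have hh : (D.highLabel v).coeff ≠ 0 := by
      rcases hD.factoring v with h | ⟨-, h⟩
      · simp [h, PauliLIM.one] at hl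
      · simp [h, PauliLIM.one]
    rw [hD.zero_edge v (Or.inl hl)]
    exact ⟨h1 hh, h1 hh⟩
  · refine ⟨h0 hl, ?_⟩
    by_cases hh : (D.highLabel v).coeff = 0
    · rw [← hD.zero_edge v (Or.inr hh)]; exact h0 hl
    · exact h1 hh

theorem isSubvector_root {φ : QVec n} (hφ : φ ≠ 0) (h : D.edgeVec D.rootEdge = φ) :
    IsSubvector φ (D.nodeVec D.root) := by
  refine ⟨column D.rootLabel.string, fun x => entry D.rootLabel.string
    (column D.rootLabel.string x), D.rootLabel.coeff, (column_involutive _).injective,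
    fun x => entry_pow_four _ _, ?_, fun x => ?_⟩
  · intro h0
    apply hφ
    funext x
    rw [← h, edgeVec_eq]
    change D.rootLabel.coeff * _ = 0
    rw [h0, zero_mul]
  · rw [← h, edgeVec_eq]
    change D.rootLabel.coeff * (_ * D.nodeVec D.root (column D.rootLabel.string _)) = _
    rw [column_involutive]; rfl

/-- The squared norm of the vector of a node. -/
noncomputable def nodeNormSq {m : ℕ} (v : D.Node m) : ℝ := ∑ x, Complex.normSq (D.nodeVec v x)

/-! ## Runs of the algorithms -/

/-- All logged numbers lie in `R` and all cached numbers are squared norms. -/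
structure Memory.Sound (R : Set ℂ) (s : D.Memory) : Prop where
  log_mem : ∀ z ∈ s.log, z ∈ R
  cache_eq : ∀ {m : ℕ} (v : D.Node m) (z : ℂ), s.cache m v = some z → z = (nodeNormSq v : ℝ)

/-- Started in a sound memory, `a` returns a value with property `Q` and keeps the memory sound. -/
def Algorithm.Sound (R : Set ℂ) {α : Type} (a : D.Algorithm α) (Q : α → Prop) : Prop :=
  ∀ s : D.Memory, s.Sound R → (a.run s).2.Sound R ∧ Q (a.run s).1

variable {R : Set ℂ} {α β : Type}

theorem sound_pure {Q : α → Prop} (x : α) (hx : Q x) :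
    Algorithm.Sound R (pure x : D.Algorithm α) Q := fun _ hs => ⟨hs, hx⟩

theorem Algorithm.Sound.bind {a : D.Algorithm α} {f : α → D.Algorithm β} {Q : α → Prop}
    {Q' : β → Prop} (ha : Algorithm.Sound R a Q) (hf : ∀ x, Q x → Algorithm.Sound R (f x) Q') :
    Algorithm.Sound R (a >>= f) Q' := fun s hs =>
  hf _ (ha s hs).2 _ (ha s hs).1

theorem sound_compute {z : ℂ} (hz : z ∈ R) : Algorithm.Sound R (D.compute z) (· = z) := by
  intro s hs
  refine ⟨⟨?_, hs.cache_eq⟩, rfl⟩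
  intro w hw
  rcases List.mem_cons.1 hw with rfl | hw
  exacts [hz, hs.log_mem _ hw]

theorem sound_lookup {m : ℕ} (v : D.Node m) :
    Algorithm.Sound R (D.lookup v) (fun o => ∀ z, o = some z → z = (nodeNormSq v : ℝ)) :=
  fun _ hs => ⟨hs, fun z hz => hs.cache_eq v z hz⟩

theorem sound_store {m : ℕ} (v : D.Node m) :
    Algorithm.Sound R (D.store v (nodeNormSq v : ℝ)) (fun _ => True) := by
  intro s hs
  refine ⟨⟨hs.log_mem, fun {m'} w z hz => ?_⟩, trivial⟩
  simp only [store, StateT.run_modify] at hz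
  classical
  change ite _ _ _ = some z at hz
  split_ifs at hz with h
  · cases h
    exact (Option.some.inj hz).symm
  · exact hs.cache_eq w z hz

theorem sound_follow {m : ℕ} (j : Fin 2) (e : D.Edge (m + 1)) {y : Fin 2} {γ : ℂ}
    {child : D.Edge m} {A : PauliLIM m} (hy : y = (e.label.string 0).column j)
    (hγ : γ = e.label.coeff * (e.label.string 0).mat j y) (hc : child = D.childEdge e.target y)
    (hA : A = PauliLIM.mul ⟨γ, Fin.tail e.label.string⟩ child.label)
    (h1 : e.label.coeff ∈ R) (h2 : γ ∈ R) (h3 : child.label.coeff ∈ R)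
    (h4 : γ * child.label.coeff ∈ R)
    (h5 : phase ⟨γ, Fin.tail e.label.string⟩ child.label ∈ R) (h6 : A.coeff ∈ R) :
    Algorithm.Sound R (D.follow j e) (· = ⟨A, child.target⟩) := by
  subst hc hA hγ hy
  unfold follow
  refine (sound_compute h1).bind ?_
  rintro _ rfl
  refine (sound_compute h2).bind ?_
  rintro _ rfl
  refine (sound_compute h3).bind ?_
  rintro _ rfl
  refine (sound_compute h4).bind fun _ _ => ?_
  refine (sound_compute h5).bind fun _ _ => ?_
  refine (sound_compute h6).bind fun _ _ => ?_
  exact sound_pure _ rfl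

theorem IsNormalized.exists_coeff_eq (hD : D.IsNormalized) {m : ℕ} (v : D.Node (m + 1))
    (y : Fin 2) : ∃ (x : Fin m → Fin 2) (u : ℂ), u ^ 4 = 1 ∧
      (D.childEdge v y).label.coeff = u * D.nodeVec v (Fin.cons y x) := by
  obtain ⟨x, hx⟩ := hD.exists_nodeVec_eq_one (D.childEdge v y).target
  have hu := entry_pow_four (D.childEdge v y).label.string
    (column (D.childEdge v y).label.string x)
  refine ⟨column (D.childEdge v y).label.string x, _, inv_pow_four hu, ?_⟩
  rw [nodeVec_cons, column_involutive, hx, mul_one, mul_left_comm,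
    inv_mul_cancel₀ (ne_zero_of_pow_four hu), mul_one]

theorem normSq_coeff_mul_nodeNormSq {m : ℕ} (v : D.Node (m + 1)) (y : Fin 2) :
    Complex.normSq (D.childEdge v y).label.coeff * nodeNormSq (D.childEdge v y).target =
      ∑ x : Fin m → Fin 2, Complex.normSq (D.nodeVec v (Fin.cons y x)) := by
  rw [nodeNormSq, Finset.mul_sum,
    ← Equiv.sum_comp (column_involutive (D.childEdge v y).label.string).toPerm]
  refine Finset.sum_congr rfl fun x _ => ?_
  rw [nodeVec_cons, Complex.normSq_mul, Complex.normSq_mul,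
    normSq_of_pow_four (entry_pow_four _ _), one_mul]
  rfl

theorem sum_cons_eq {m : ℕ} (f : (Fin (m + 1) → Fin 2) → ℝ) (y : Fin 2) :
    ∑ x : Fin m → Fin 2, f (Fin.cons y x) =
      ∑ x ∈ Finset.univ.image (Fin.cons (α := fun _ => Fin 2) y), f x := by
  rw [Finset.sum_image fun a _ b _ hab => Fin.cons_right_injective _ hab]

theorem sum_cons_add_sum_cons {m : ℕ} (f : (Fin (m + 1) → Fin 2) → ℝ) :
    ∑ x : Fin m → Fin 2, f (Fin.cons 0 x) + ∑ x : Fin m → Fin 2, f (Fin.cons 1 x) =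
      ∑ x, f x := by
  rw [← (Fin.consEquiv fun _ => Fin 2).sum_comp, Fintype.sum_prod_type, Fin.sum_univ_two]
  rfl

theorem sound_squaredNorm (hD : D.IsNormalized) {φ : QVec n} (hR : AmplitudeRatiosIn φ R) :
    ∀ {m : ℕ} (e : D.Edge m), IsSubvector φ (D.nodeVec e.target) → e.label.coeff ∈ R →
      ((Complex.normSq e.label.coeff : ℝ) : ℂ) ∈ R →
      ((Complex.normSq e.label.coeff * nodeNormSq e.target : ℝ) : ℂ) ∈ R →
      Algorithm.Sound R (D.squaredNorm e)
        (· = ((Complex.normSq e.label.coeff * nodeNormSq e.target : ℝ) : ℂ))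
  | 0, e, _, h1, h2, _ => by
    have h0 : nodeNormSq e.target = 1 := by simp [nodeNormSq, nodeVec]
    rw [squaredNorm, h0, mul_one]
    refine (sound_compute h1).bind ?_
    rintro _ rfl
    exact sound_compute h2
  | m + 1, ⟨A, v⟩, hv, h1, h2, h3 => by
    dsimp only at hv h1 h2 h3 ⊢
    obtain ⟨x₀, hx₀⟩ := hD.exists_nodeVec_eq_one v
    have hunit : ∀ w : ℂ, w ^ 4 = 1 → w ∈ R := fun w hw => by
      simpa [hx₀] using hv.unit_mul_mem hR hx₀ hw x₀
    have h_one : (1 : ℂ) ∈ R := hunit 1 (by norm_num)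
    have hN : ((nodeNormSq v : ℝ) : ℂ) ∈ R := hv.sum_mem hR hx₀ _
    have step : ∀ (j : Fin 2), Algorithm.Sound R
        (do D.squaredNorm (← D.follow j ⟨PauliLIM.one (m + 1), v⟩))
        (· = ((∑ x : Fin m → Fin 2, Complex.normSq (D.nodeVec v (Fin.cons j x)) : ℝ) : ℂ)) := by
      intro j
      obtain ⟨x, u, hu, hα⟩ := hD.exists_coeff_eq v j
      have hα_mem : (D.childEdge v j).label.coeff ∈ R := by
        rw [hα]; exact hv.unit_mul_mem hR hx₀ hu _
      have hα_normSq : ((Complex.normSq (D.childEdge v j).label.coeff : ℝ) : ℂ) ∈ R := by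
        have := hv.sum_mem hR hx₀ {Fin.cons j x}
        rw [Finset.sum_singleton] at this
        rwa [hα, Complex.normSq_mul, normSq_of_pow_four hu, one_mul]
      have hγ : (1 : ℂ) = (PauliLIM.one (m + 1)).coeff *
          ((PauliLIM.one (m + 1)).string 0).mat j j := by
        fin_cases j <;> simp [PauliLIM.one, Pauli.mat]
      have hphase : phase ⟨1, Fin.tail (PauliLIM.one (m + 1)).string⟩
          (D.childEdge v j).label = 1 := phase_identity _ _
      have hcoeff : (PauliLIM.mul ⟨1, Fin.tail (PauliLIM.one (m + 1)).string⟩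
          (D.childEdge v j).label).coeff = (D.childEdge v j).label.coeff := by
        rw [PauliLIM.mul, hphase]; simp
      refine (sound_follow j _ (y := j) rfl hγ rfl rfl h_one h_one hα_mem
        (by rwa [one_mul]) (by rwa [hphase]) (by rwa [hcoeff])).bind ?_
      rintro _ rfl
      rw [← normSq_coeff_mul_nodeNormSq, ← hcoeff]
      refine sound_squaredNorm hD hR _ (hD.isSubvector_child hv j) (by rwa [hcoeff])
        (by rwa [hcoeff]) ?_
      rw [hcoeff, normSq_coeff_mul_nodeNormSq, sum_cons_eq fun x => Complex.normSq (D.nodeVec v x)]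
      exact hv.sum_mem hR hx₀ _
    rw [squaredNorm]
    refine Algorithm.Sound.bind (Q := (· = ((nodeNormSq v : ℝ) : ℂ))) ?_ ?_
    · refine (sound_lookup v).bind fun o ho => ?_
      cases o with
      | some s =>
        obtain rfl := ho s rfl
        exact sound_compute hN
      | none =>
        dsimp only
        rw [← bind_assoc]
        refine (step 0).bind ?_
        rintro _ rfl
        rw [← bind_assoc]
        refine (step 1).bind ?_
        rintro _ rfl
        have hsum := sum_cons_add_sum_cons fun x => Complex.normSq (D.nodeVec v x)
        rw [← Complex.ofReal_add, hsum]
        refine (sound_compute hN).bind ?_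
        rintro _ rfl
        exact (sound_store v).bind fun _ _ => sound_pure _ rfl
    · rintro _ rfl
      refine (sound_compute h1).bind ?_
      rintro _ rfl
      refine (sound_compute h2).bind ?_
      rintro _ rfl
      rw [Complex.ofReal_mul] at h3 ⊢
      exact sound_compute h3

theorem edgeVec_cons {m : ℕ} (e : D.Edge (m + 1)) (j : Fin 2) (x : Fin m → Fin 2) :
    D.edgeVec e (Fin.cons j x) =
      e.label.coeff * (e.label.string 0).mat j ((e.label.string 0).column j) *
        (entry (Fin.tail e.label.string) x * D.nodeVec e.target
          (Fin.cons ((e.label.string 0).column j) (column (Fin.tail e.label.string) x))) := by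
  rw [edgeVec_eq]
  have h1 : column e.label.string (Fin.cons j x) =
      Fin.cons ((e.label.string 0).column j) (column (Fin.tail e.label.string) x) := by
    funext i
    refine Fin.cases rfl (fun i => rfl) i
  have h2 : entry e.label.string (Fin.cons j x) = (e.label.string 0).mat j
      ((e.label.string 0).column j) * entry (Fin.tail e.label.string) x := by
    rw [entry, Fin.prod_univ_succ]; rfl
  rw [h1, h2]; ring

theorem normSq_coeff_mul_sum {m : ℕ} (e : D.Edge (m + 1)) (j : Fin 2) :
    Complex.normSq e.label.coeff * ∑ x : Fin m → Fin 2, Complex.normSq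
      (D.nodeVec e.target (Fin.cons ((e.label.string 0).column j) x)) =
      ∑ x : Fin m → Fin 2, Complex.normSq (D.edgeVec e (Fin.cons j x)) := by
  rw [Finset.mul_sum, ← Equiv.sum_comp (column_involutive (Fin.tail e.label.string)).toPerm]
  refine Finset.sum_congr rfl fun x _ => ?_
  rw [edgeVec_cons, Complex.normSq_mul, Complex.normSq_mul, Complex.normSq_mul,
    normSq_of_pow_four (entry_pow_four _ _), normSq_of_pow_four (Pauli.mat_column_pow_four _ _),
    one_mul, mul_one]
  rfl

theorem exists_edge_coeff_eq (hD : D.IsNormalized) {m : ℕ} (e : D.Edge m) :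
    ∃ (x : Fin m → Fin 2) (u : ℂ), u ^ 4 = 1 ∧ e.label.coeff = u * D.edgeVec e x := by
  obtain ⟨x, hx⟩ := hD.exists_nodeVec_eq_one e.target
  have hu := entry_pow_four e.label.string (column e.label.string x)
  refine ⟨column e.label.string x, _, inv_pow_four hu, ?_⟩
  rw [edgeVec_eq, column_involutive, hx, mul_one, mul_left_comm,
    inv_mul_cancel₀ (ne_zero_of_pow_four hu), mul_one]

theorem sound_squaredNorm_root (hD : D.IsNormalized) {φ : QVec n}
    (hR : AmplitudeRatiosIn φ R) (hφ : φ ≠ 0) (hroot : D.edgeVec D.rootEdge = φ) :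
    Algorithm.Sound R (D.squaredNorm D.rootEdge) fun _ => True := by
  obtain ⟨x, u, hu, hc⟩ := exists_edge_coeff_eq hD D.rootEdge
  rw [hroot] at hc
  have hsq : ((Complex.normSq D.rootEdge.label.coeff : ℝ) : ℂ) ∈ R := by
    have := hR.sum {x}
    rw [Finset.sum_singleton] at this
    rwa [hc, Complex.normSq_mul, normSq_of_pow_four hu, one_mul]
  have hmul : Complex.normSq D.rootEdge.label.coeff * nodeNormSq D.rootEdge.target =
      ∑ x, Complex.normSq (φ x) := by
    rw [nodeNormSq, Finset.mul_sum,
      ← Equiv.sum_comp (column_involutive D.rootEdge.label.string).toPerm, ← hroot]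
    refine Finset.sum_congr rfl fun x _ => ?_
    rw [edgeVec_eq, Complex.normSq_mul, Complex.normSq_mul,
      normSq_of_pow_four (entry_pow_four _ _), one_mul]
    rfl
  have := sound_squaredNorm hD hR D.rootEdge (isSubvector_root hφ hroot)
    (by rw [hc]; exact hR.unit_mul x hu) hsq (by rw [hmul]; exact hR.sum _)
  exact fun s hs => ⟨(this s hs).1, trivial⟩

theorem sound_measurementProbability {D : LIMDD (n + 1)} (hD : D.IsNormalized)
    {φ : QVec (n + 1)} (hR : AmplitudeRatiosIn φ R) (hφ : φ ≠ 0)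
    (hroot : D.edgeVec D.rootEdge = φ) :
    Algorithm.Sound R (D.measurementProbability D.rootEdge) fun _ => True := by
  have hv := isSubvector_root hφ hroot
  generalize he : D.rootEdge = e at hroot
  have hv : IsSubvector φ (D.nodeVec e.target) := by rw [← he]; exact hv
  obtain ⟨x₀, hx₀⟩ := hD.exists_nodeVec_eq_one e.target
  have hunit : ∀ w : ℂ, w ^ 4 = 1 → w ∈ R := fun w hw => by
    simpa [hx₀] using hv.unit_mul_mem hR hx₀ hw x₀
  have step : ∀ (j : Fin 2), Algorithm.Sound R (do D.squaredNorm (← D.follow j e))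
      (· = ((∑ x : Fin n → Fin 2, Complex.normSq (φ (Fin.cons j x)) : ℝ) : ℂ)) := by
    intro j
    generalize hy : (e.label.string 0).column j = y
    obtain ⟨x, u, hu, hc⟩ := exists_edge_coeff_eq hD e
    rw [hroot] at hc
    have hmat : (e.label.string 0).mat j y ^ 4 = 1 := by
      rw [← hy]; exact Pauli.mat_column_pow_four _ _
    obtain ⟨x', u', hu', hα⟩ := hD.exists_coeff_eq e.target y
    generalize hγ : e.label.coeff * (e.label.string 0).mat j y = γ
    generalize hB : (⟨γ, Fin.tail e.label.string⟩ : PauliLIM n) = B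
    have hphase := phase_pow_four B (D.childEdge e.target y).label
    have hγα : ∃ (x : Fin n → Fin 2) (u : ℂ), u ^ 4 = 1 ∧
        γ * (D.childEdge e.target y).label.coeff = u * φ (Fin.cons j x) := by
      have hw := entry_pow_four (Fin.tail e.label.string) (column (Fin.tail e.label.string) x')
      refine ⟨column (Fin.tail e.label.string) x', _, mul_pow_four hu' (inv_pow_four hw), ?_⟩
      rw [← hroot, edgeVec_cons, column_involutive, hα, hy, hγ]
      have := ne_zero_of_pow_four hw
      field_simp
    obtain ⟨z, w, hw, hγα⟩ := hγα
    have hcoeff : (PauliLIM.mul B (D.childEdge e.target y).label).coeff =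
        phase B (D.childEdge e.target y).label * w * φ (Fin.cons j z) := by
      rw [mul_assoc, ← hγα, mul_comm (phase _ _), ← hB]; rfl
    have hnormSq : Complex.normSq (PauliLIM.mul B (D.childEdge e.target y).label).coeff *
        nodeNormSq (D.childEdge e.target y).target =
        ∑ x : Fin n → Fin 2, Complex.normSq (φ (Fin.cons j x)) := by
      rw [hcoeff, mul_assoc, ← hγα, ← hγ, Complex.normSq_mul, Complex.normSq_mul,
        Complex.normSq_mul, normSq_of_pow_four hphase, normSq_of_pow_four hmat, one_mul, mul_one,
        mul_assoc, normSq_coeff_mul_nodeNormSq, ← hroot, ← normSq_coeff_mul_sum, hy]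
    have hcoeff_mem : (PauliLIM.mul B (D.childEdge e.target y).label).coeff ∈ R := by
      rw [hcoeff]; exact hR.unit_mul _ (mul_pow_four hphase hw)
    refine (sound_follow j e (y := y) hy.symm hγ.symm rfl rfl
      (by rw [hc]; exact hR.unit_mul _ hu)
      (by rw [← hγ, hc, mul_right_comm]; exact hR.unit_mul _ (mul_pow_four hu hmat))
      (by rw [hα]; exact hv.unit_mul_mem hR hx₀ hu' _)
      (by rw [hγα]; exact hR.unit_mul _ hw)
      (by rw [hB]; exact hunit _ hphase) (by rw [hB]; exact hcoeff_mem)).bind ?_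
    rintro _ rfl
    rw [hB, ← hnormSq]
    refine sound_squaredNorm hD hR _ (hD.isSubvector_child hv y) hcoeff_mem ?_ ?_
    · have := hR.sum {Fin.cons j z}
      rw [Finset.sum_singleton] at this
      dsimp only
      rwa [hcoeff, Complex.normSq_mul, normSq_of_pow_four (mul_pow_four hphase hw), one_mul]
    · rw [hnormSq, sum_cons_eq fun x => Complex.normSq (φ x)]
      exact hR.sum _
  unfold measurementProbability
  rw [← bind_assoc]
  refine (step 0).bind ?_
  rintro _ rfl
  rw [← bind_assoc]
  refine (step 1).bind ?_
  rintro _ rfl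
  rw [← Complex.ofReal_add, sum_cons_add_sum_cons fun x => Complex.normSq (φ x)]
  refine (sound_compute (hR.sum _)).bind ?_
  rintro _ rfl
  rw [← Complex.ofReal_div, sum_cons_eq fun x => Complex.normSq (φ x)]
  refine fun s hs => ⟨(sound_compute (hR.sum_div _ ?_) s hs).1, trivial⟩
  intro h0
  rw [Finset.sum_eq_zero_iff_of_nonneg fun x _ => Complex.normSq_nonneg _] at h0
  exact hφ (funext fun x => by simpa using h0 x (Finset.mem_univ x))

theorem encountered_subset {a : D.Algorithm α} {Q : α → Prop} (h : Algorithm.Sound R a Q) :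
    ∀ z ∈ D.encountered a, z ∈ R :=
  (h D.initialMemory ⟨by simp [initialMemory], by simp [initialMemory]⟩).1.log_mem

end LIMDD

theorem mainTheorem2 :
    ∃ C : ℕ, ∀ (n : ℕ) (circuit : List (Gate (n + 1))) (D : LIMDD (n + 1)),
      D.IsNormalized →
      D.edgeVec D.rootEdge = circuitState circuit →
      (∀ z ∈ D.encountered (D.measurementProbability D.rootEdge),
        z ∈ RNumbers (C * ((n + 1) + tCount circuit))) ∧
      (∀ z ∈ D.encountered (D.squaredNorm D.rootEdge),
        z ∈ RNumbers (C * ((n + 1) + tCount circuit))) := by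
  refine ⟨8, fun n circuit D hD h => ?_⟩
  have hR := amplitudeRatiosIn_circuitState circuit
  have hφ := circuitState_ne_zero circuit
  exact ⟨LIMDD.encountered_subset (LIMDD.sound_measurementProbability hD hR hφ h),
    LIMDD.encountered_subset (LIMDD.sound_squaredNorm_root hD hR hφ h)⟩
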